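/- Let $\Omega=[-1,1]$, let $\xi\in\Omega$, let $\sigma>0$, let $g$ be a real-valued function that is analytic in a neighborhood of $\Omega$, and let $f(x)=|x-\xi|^{\sigma}g(x)$ for $x\in\Omega$. Assume that $\sigma$ is not an even integer when $\xi\in(-1,1)$, and that $\sigma$ is not an integer when $\xi=\pm1$. For $n\ge 1$ let $p_n$ be the polynomial of degree at most $n$ that interpolates $f$ at the Chebyshev--Lobatto points $x_j=\cos(j\pi/n)$, $j=0,\dots,n$. Let $m\ge 0$ be an integer. Derivatives of $f$ at $\pm1$ are one-sided, and the constants in the $O$-terms below may depend on $x$, $m$, $\xi$, $\sigma$ and $g$, but not on $n$. Then, as $n\to\infty$, the following holds. (i) If $\xi\in(-1,1)$ and $m<\min\{\sigma,\,1+\sigma/2\}$, then $f\in C^m(\Omega)$ and $$f^{(m)}(x)-p_n^{(m)}(x)=\begin{cases}O(n^{m-\sigma}), & x=\xi,\\ O(n^{m-1-\sigma}), & x\in(-1,\xi)\cup(\xi,1),\\ O(n^{2m-2-\sigma}), & x=\pm1,\end{cases}$$ where the last estimate is for $m\ge1$; when $m=0$ the error at $x=\pm1$ is zero for all $n\ge1$.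 (ii) If $\xi=\pm1$ and $m<\sigma$, then $f\in C^m(\Omega)$ and $$f^{(m)}(x)-p_n^{(m)}(x)=\begin{cases}O(n^{m-1-2\sigma}), & x\in(-1,1),\\ O(n^{2m-2\sigma}), & x=\xi,\\ O(n^{2m-2-2\sigma}), & x=-\xi,\end{cases}$$ where the last two estimates are for $m\ge1$; when $m=0$ the errors at $x=\pm\xi$ are zero for all $n\ge1$. -/

import Mathlib

open Set Filter Asymptotics Polynomial

noncomputable section

/-- The model function `f(x) = |x - ξ|^σ g(x)`. -/
def modelFun (ξ σ : ℝ) (g : ℝ → ℝ) (x : ℝ) : ℝ :=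
  |x - ξ| ^ σ * g x

/-- The polynomial `p_n` of degree at most `n` that interpolates `f` at the `n + 1`
Chebyshev–Lobatto points `x_j = cos (j π / n)`, `j = 0, …, n` (for `n ≥ 1`); these points are
Mathlib's `Polynomial.Chebyshev.node n j`. -/
def chebInterp (f : ℝ → ℝ) (n : ℕ) : ℝ[X] :=
  Lagrange.interpolate (Finset.range (n + 1)) (Chebyshev.node n)
    (fun j => f (Chebyshev.node n j))

/-- The pointwise error `f^{(m)}(x) - p_n^{(m)}(x)`. The function `f` lives on `[-1, 1]`, so its
derivatives are taken within `[-1, 1]`; they are one-sided at `x = ±1`. -/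
def chebDiffError (f : ℝ → ℝ) (m n : ℕ) (x : ℝ) : ℝ :=
  iteratedDerivWithin m f (Icc (-1) 1) x - (derivative^[m] (chebInterp f n)).eval x

end

/-! Everything rests on one weighted pointwise bound, `HasLobattoErrorBound`: for large `n`, `|f -
p_n|(x) * |x - ξ| ≤ C √(1 - x²) n^(-1-e)` on `[-1,1]`, with `e = σ` for an interior singularity and
`e = 2σ` for one at an endpoint.

To obtain it, let `ω = (X² - 1) U_{n-1}` be the nodal polynomial. If `deg h ≤ n + 1`, the error of
interpolating `h(y)/(y - z)` is exactly `h(z) ω(x) / (ω(z) (x - z))` (`lobattoError_div`). On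
`[-1,1]` one has `|ω| ≤ √(1 - x²)`, while `|ω(cos θ)| = |sin θ| |sin nθ|` is large off the interval.
A fractional power is a superposition of such rational functions (`exists_rpow_eq_integral`), with
poles `ξ ± it` for an interior singularity and `ξ(1 + t)` for an endpoint one. Integrating the
kernel errors and rescaling `t` by `n`, respectively `n²`, produces the rate. A Taylor expansion of
`g` at `ξ` leaves powers, covered by this, and a smooth remainder, which is a superposition of
functions `|y - t|^r` plus a polynomial.

Derivatives are reached through `Q = p_{2n} - p_n`, a polynomial obeying the same bound. Away from
`±1`, Bernstein's inequality costs a factor `n` per derivative; up to the endpoints, Markov's costs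
`n²`. At an endpoint other than `ξ`, the factor `√(1 - x²)` lowers the cost of the first derivative
to `n`. Near `ξ` the weighted bound degenerates, but only on a gap of width of order `1/n` (or
`1/n²` at an endpoint), across which a polynomial of degree `2n` cannot grow much. Summing over `n,
2n, 4n, …` gives a geometric series whenever the resulting exponent is negative, which is what the
restrictions on `m` ensure; the sum identifies the derivatives of `f` and bounds the error
(`exists_abs_iteratedDerivWithin_sub_le`). -/

/-! ### Markov and Bernstein inequalities, and control across gaps. -/

/-- Markov's inequality at the endpoint `x` of the segment between `c` and `x`. -/
lemma abs_derivative_eval_mul_le {P : ℝ[X]} {N : ℕ} (hN : P.natDegree ≤ N) {M c x : ℝ}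
    (hM : 0 < M) (hP : ∀ y ∈ uIcc c x, |P.eval y| ≤ M) :
    |P.derivative.eval x| * |x - c| ≤ 2 * N ^ 2 * M := by
  -- The extremal property of Chebyshev polynomials is one-sided; the sign `s` turns it into a bound
  -- on the absolute value.
  have key : ∀ s : ℝ, |s| = 1 → s * (P.derivative.eval x * (x - c)) ≤ 2 * N ^ 2 * M := by
    intro s hs
    set R : ℝ[X] := C (s / M) * P.comp (C ((x - c) / 2) * X + C ((x + c) / 2)) with hR
    have hdeg : R.degree ≤ N := by
      refine natDegree_le_iff_degree_le.1 ((natDegree_C_mul_le _ _).trans ?_)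
      refine natDegree_comp_le.trans ?_
      calc P.natDegree * _ ≤ N * 1 := Nat.mul_le_mul hN natDegree_linear_le
        _ = N := mul_one _
    have hbd : ∀ y ∈ Icc (-1 : ℝ) 1, |R.eval y| ≤ 1 := by
      intro y hy
      have hmem : (x - c) / 2 * y + (x + c) / 2 ∈ uIcc c x := by
        have h : (x - c) / 2 * y + (x + c) / 2 = c + ((1 + y) / 2) * (x - c) := by ring
        rw [h, ← segment_eq_uIcc, segment_eq_image']
        exact ⟨(1 + y) / 2, ⟨by linarith [hy.1], by linarith [hy.2]⟩, by simp⟩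
      have := hP _ hmem
      simp only [hR, eval_mul, eval_C, eval_comp, eval_add, eval_X, abs_mul, abs_div, hs,
        abs_of_pos hM]
      rw [div_mul_eq_mul_div, one_mul]
      exact (div_le_one hM).2 this
    have h := Chebyshev.eval_iterate_derivative_le_of_forall_abs_le_one (k := 1) le_rfl hdeg hbd
    simp only [Function.iterate_one, Chebyshev.derivative_T_eval_one] at h
    simp only [hR, derivative_mul, derivative_C, zero_mul, zero_add, derivative_comp,
      derivative_add, derivative_X, eval_mul, eval_C, eval_comp, eval_add, eval_X, mul_one,
      add_zero] at h
    have e : (x - c) / 2 + (x + c) / 2 = x := by ring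
    rw [e] at h
    have h' : s * (P.derivative.eval x * (x - c)) / (2 * M) ≤ (N : ℝ) ^ 2 := by
      refine le_trans (le_of_eq ?_) (by simpa using h)
      field_simp
    rw [div_le_iff₀ (by positivity)] at h'
    linarith
  rw [← abs_mul]
  have h1 := key 1 (by simp)
  have h2 := key (-1) (by simp)
  exact abs_le.2 ⟨by linarith, by linarith⟩

/-- Markov's inequality on an interval. -/
lemma abs_derivative_eval_le_markov {P : ℝ[X]} {N : ℕ} (hN : P.natDegree ≤ N) {M a b : ℝ}
    (hab : a < b) (hM : 0 < M) (hP : ∀ y ∈ Icc a b, |P.eval y| ≤ M) {x : ℝ} (hx : x ∈ Icc a b) :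
    |P.derivative.eval x| ≤ 4 * N ^ 2 / (b - a) * M := by
  have hba : 0 < b - a := sub_pos.2 hab
  -- Take for `c` the endpoint farther from `x`.
  obtain ⟨c, hc, hcx⟩ : ∃ c ∈ Icc a b, (b - a) / 2 ≤ |x - c| := by
    rcases le_total x ((a + b) / 2) with h | h
    · exact ⟨b, right_mem_Icc.2 hab.le, by rw [abs_sub_comm]; exact le_trans (by linarith) (le_abs_self _)⟩
    · exact ⟨a, left_mem_Icc.2 hab.le, le_trans (by linarith) (le_abs_self _)⟩
  have h := abs_derivative_eval_mul_le hN (c := c) (x := x) hM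
    (fun y hy => hP y (uIcc_subset_Icc hc hx hy))
  have h2 : |P.derivative.eval x| * ((b - a) / 2) ≤ 2 * N ^ 2 * M :=
    (mul_le_mul_of_nonneg_left hcx (abs_nonneg _)).trans h
  rw [div_mul_eq_mul_div, le_div_iff₀ hba]
  linarith

lemma natDegree_iterate_derivative_le {P : ℝ[X]} {N : ℕ} (hN : P.natDegree ≤ N) (j : ℕ) :
    (derivative^[j] P).natDegree ≤ N :=
  (natDegree_iterate_derivative P j).trans ((Nat.sub_le _ _).trans hN)

lemma abs_iterate_derivative_eval_le_markov {P : ℝ[X]} {N : ℕ} (hN : P.natDegree ≤ N)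
    (hN1 : 1 ≤ N) {M a b : ℝ}
    (hab : a < b) (hM : 0 < M) (hP : ∀ y ∈ Icc a b, |P.eval y| ≤ M) (j : ℕ) :
    ∀ x ∈ Icc a b, |(derivative^[j] P).eval x| ≤ (4 * N ^ 2 / (b - a)) ^ j * M := by
  have hba : 0 < b - a := sub_pos.2 hab
  have hN0 : (0 : ℝ) < N := by exact_mod_cast hN1
  induction j with
  | zero => simpa using hP
  | succ j ih =>
    intro x hx
    rw [Function.iterate_succ_apply']
    refine (abs_derivative_eval_le_markov (natDegree_iterate_derivative_le hN j) hab
      (by positivity) ih hx).trans (le_of_eq ?_)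
    ring

/-- A polynomial dominated by `M / √u` on `(0, 1]` is `O(N M)` at the origin. -/
lemma abs_eval_zero_le_of_abs_eval_mul_sqrt_le {S : ℝ[X]} {N : ℕ} (hN : S.natDegree ≤ N)
    (hN1 : 1 ≤ N) {M : ℝ} (hM : 0 < M) (hS : ∀ u ∈ Ioc (0 : ℝ) 1, |S.eval u| * √u ≤ M) :
    |S.eval 0| ≤ 8 * N * M := by
  have hN0 : (0 : ℝ) < N := by exact_mod_cast hN1
  have hN1' : (1 : ℝ) ≤ N := by exact_mod_cast hN1
  -- This choice gives `T_N(c) = cosh 1 ≤ 2`. The affine map taking `1, -1` to `δ, 1` takes `c` to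
  -- `0`, and `δ` is at least `1/(6N²)`, so the hypothesis bounds `S` by `3NM` on `[δ, 1]` and
  -- extrapolation to `0` at most doubles this.
  set c := Real.cosh (1 / N) with hc
  have hc1 : 1 + (1 / N : ℝ) ^ 2 / 2 ≤ c := by
    have := Real.cosh_sq' (1 / (2 * N : ℝ))
    have h2 := Real.cosh_two_mul (1 / (2 * N : ℝ))
    have h3 : 2 * (1 / (2 * N : ℝ)) = 1 / N := by field_simp
    rw [h3, ← hc] at h2
    have h4 : 1 / (2 * N : ℝ) ≤ Real.sinh (1 / (2 * N)) := Real.self_le_sinh_iff.2 (by positivity)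
    have h5 : (1 / (2 * N : ℝ)) ^ 2 ≤ Real.sinh (1 / (2 * N)) ^ 2 := by gcongr
    have h6 : (1 / N : ℝ) ^ 2 / 2 = 2 * (1 / (2 * N : ℝ)) ^ 2 := by field_simp
    nlinarith
  have hcosh1 : Real.cosh 1 ≤ 2 := by
    rw [Real.cosh_eq]
    have := Real.exp_one_lt_d9
    have h2 : Real.exp (-1) ≤ 1 := Real.exp_le_one_iff.2 (by norm_num)
    linarith
  have hc2 : c ≤ 2 := by
    refine le_trans ?_ hcosh1
    rw [hc, Real.cosh_le_cosh, abs_of_pos (by positivity), abs_one]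
    exact (div_le_one hN0).2 hN1'
  set δ := (c - 1) / (c + 1) with hδ
  have hsq : 0 < (1 / N : ℝ) ^ 2 := by positivity
  have hδ1 : (1 / N : ℝ) ^ 2 / 6 ≤ δ := by
    rw [hδ, le_div_iff₀ (by linarith)]
    nlinarith
  have hδpos : 0 < δ := lt_of_lt_of_le (by positivity) hδ1
  have hδlt : δ < 1 := by rw [hδ, div_lt_one (by linarith)]; linarith
  have hsqrt : 1 / (3 * N : ℝ) ≤ √δ := by
    refine Real.le_sqrt_of_sq_le (le_trans ?_ hδ1)
    have : (1 / (3 * N : ℝ)) ^ 2 = (1 / N : ℝ) ^ 2 / 9 := by field_simp; norm_num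
    linarith
  have key : ∀ s : ℝ, |s| = 1 → s * S.eval 0 ≤ 8 * N * M := by
    intro s hs
    set R : ℝ[X] := C (s / (3 * N * M)) * S.comp (C (-(1 - δ) / 2) * X + C ((1 + δ) / 2)) with hR
    have hdeg : R.degree ≤ N := by
      refine natDegree_le_iff_degree_le.1 ((natDegree_C_mul_le _ _).trans ?_)
      refine natDegree_comp_le.trans ?_
      calc S.natDegree * _ ≤ N * 1 := Nat.mul_le_mul hN natDegree_linear_le
        _ = N := mul_one _
    have hbd : ∀ y ∈ Icc (-1 : ℝ) 1, |R.eval y| ≤ 1 := by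
      intro y hy
      set u := -(1 - δ) / 2 * y + (1 + δ) / 2 with hu
      have hu1 : δ ≤ u := by nlinarith [hy.2]
      have hu2 : u ≤ 1 := by nlinarith [hy.1]
      have h1 := hS u ⟨by linarith, hu2⟩
      have h2 : 1 / (3 * N : ℝ) ≤ √u := hsqrt.trans (Real.sqrt_le_sqrt hu1)
      have h3 : |S.eval u| * (1 / (3 * N : ℝ)) ≤ M :=
        (mul_le_mul_of_nonneg_left h2 (abs_nonneg _)).trans h1
      have h4 : |S.eval u| ≤ 3 * N * M := by
        rw [mul_one_div, div_le_iff₀ (by positivity)] at h3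
        linarith
      simp only [hR, eval_mul, eval_C, eval_comp, eval_add, eval_X, abs_mul (s / _), abs_div, hs,
        abs_of_pos (show (0 : ℝ) < 3 * N * M by positivity)]
      rw [← hu, div_mul_eq_mul_div, one_mul]
      exact (div_le_one (by positivity)).2 h4
    have h := Chebyshev.eval_iterate_derivative_le_of_forall_abs_le_one (k := 0) (x := c)
      (by linarith) hdeg hbd
    simp only [Function.iterate_zero, id] at h
    rw [hc, Chebyshev.T_real_cosh, ← hc] at h
    have e1 : ((N : ℤ) : ℝ) * (1 / (N : ℝ)) = 1 := by push_cast; field_simp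
    rw [e1] at h
    simp only [hR, eval_mul, eval_C, eval_comp, eval_add, eval_X] at h
    have e2 : -(1 - δ) / 2 * c + (1 + δ) / 2 = 0 := by
      have : c + 1 ≠ 0 := by linarith
      rw [hδ]; field_simp; ring
    rw [e2, div_mul_eq_mul_div, div_le_iff₀ (by positivity)] at h
    nlinarith [mul_pos hN0 hM]
  have h1 := key 1 (by simp)
  have h2 := key (-1) (by simp)
  exact abs_le.2 ⟨by linarith, by linarith⟩

/-- The odd part of `P` is `x S(x²)`. With `u = x²`, a bound on `P` near `0` becomes a bound on
`S(u) √u`, and `P'(0)` becomes the value `S(0)`. -/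
lemma exists_odd_part (P : ℝ[X]) : ∃ S : ℝ[X], S.natDegree ≤ P.natDegree ∧
    (∀ x : ℝ, P.eval x - P.eval (-x) = 2 * x * S.eval (x ^ 2)) ∧
    P.derivative.eval 0 = S.eval 0 := by
  classical
  refine ⟨∑ i ∈ Finset.range (P.natDegree + 1), if Odd i then C (P.coeff i) * X ^ (i / 2) else 0,
    ?_, ?_, ?_⟩
  · refine natDegree_sum_le_of_forall_le _ _ fun i hi => ?_
    split_ifs
    · exact (natDegree_C_mul_X_pow_le _ _).trans
        ((Nat.div_le_self _ _).trans (Nat.lt_succ_iff.1 (Finset.mem_range.1 hi)))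
    · simp
  · intro x
    rw [eval_eq_sum_range, eval_eq_sum_range, ← Finset.sum_sub_distrib, eval_finsetSum,
      Finset.mul_sum]
    refine Finset.sum_congr rfl fun i _ => ?_
    rcases Nat.even_or_odd i with h | h
    · rw [if_neg (Nat.not_odd_iff_even.2 h), h.neg_pow]; simp
    · rw [if_pos h, h.neg_pow]
      obtain ⟨k, rfl⟩ := h
      have : (2 * k + 1) / 2 = k := by omega
      simp only [this, eval_mul, eval_C, eval_pow, eval_X]
      ring
  · rw [← coeff_zero_eq_eval_zero, coeff_derivative, eval_finsetSum]
    by_cases h : 1 < P.natDegree + 1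
    · rw [Finset.sum_eq_single_of_mem 1 (Finset.mem_range.2 h)]
      · simp
      · intro i _ hi
        split_ifs with ho
        · have : i / 2 ≠ 0 := by
            obtain ⟨k, rfl⟩ := ho
            omega
          simp [this]
        · simp
    · have h0 : P.natDegree = 0 := by omega
      rw [coeff_eq_zero_of_natDegree_lt (by omega), h0]
      simp

/-- Bernstein's inequality at the centre of an interval. -/
lemma abs_derivative_eval_le_bernstein {P : ℝ[X]} {N : ℕ} (hN : P.natDegree ≤ N)
    (hN1 : 1 ≤ N) {M x r : ℝ} (hr : 0 < r) (hM : 0 < M)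
    (hP : ∀ y, |y - x| ≤ r → |P.eval y| ≤ M) :
    |P.derivative.eval x| ≤ 8 * N / r * M := by
  set R : ℝ[X] := P.comp (C r * X + C x) with hR
  have hRe : ∀ y, R.eval y = P.eval (r * y + x) := by intro y; simp [hR]
  obtain ⟨S, hS1, hS2, hS3⟩ := exists_odd_part R
  have hdeg : R.natDegree ≤ N := by
    refine natDegree_comp_le.trans ?_
    calc P.natDegree * _ ≤ N * 1 := Nat.mul_le_mul hN natDegree_linear_le
      _ = N := mul_one _
  have hRb : ∀ y : ℝ, |y| ≤ 1 → |R.eval y| ≤ M := by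
    intro y hy
    rw [hRe]
    refine hP _ ?_
    rw [add_sub_cancel_right, abs_mul, abs_of_pos hr]
    exact mul_le_of_le_one_right hr.le hy
  have h0 : |S.eval 0| ≤ 8 * N * M := by
    refine abs_eval_zero_le_of_abs_eval_mul_sqrt_le (hS1.trans hdeg) hN1 hM fun u hu => ?_
    have hsu : √u ≤ 1 := Real.sqrt_le_one.2 hu.2
    have hs0 := Real.sqrt_nonneg u
    have h := hS2 (√u)
    rw [Real.sq_sqrt hu.1.le] at h
    have h1 := hRb (√u) (by rwa [abs_of_nonneg hs0])
    have h2 := hRb (-√u) (by rwa [abs_neg, abs_of_nonneg hs0])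
    have h3 : |2 * √u * S.eval u| ≤ 2 * M := by
      rw [← h]
      exact (abs_sub _ _).trans (by linarith)
    rw [abs_mul, abs_mul, abs_two, abs_of_nonneg hs0] at h3
    nlinarith
  have e : R.derivative.eval 0 = r * P.derivative.eval x := by
    simp [hR, derivative_comp]
  rw [← hS3, e, abs_mul, abs_of_pos hr] at h0
  rw [div_mul_eq_mul_div, le_div_iff₀ hr]
  linarith

/-- Iterate the inequality at the centre of an interval, spending half of the margin `s` on the last
derivative and half on the others. The constant depends only on `j`. -/
lemma exists_abs_iterate_derivative_eval_le_bernstein (j : ℕ) : ∃ K : ℝ, 0 < K ∧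
    ∀ (P : ℝ[X]) (N : ℕ) (M x₀ r s : ℝ), P.natDegree ≤ N → 1 ≤ N → 0 < s → 0 < M →
      (∀ y, |y - x₀| ≤ r + s → |P.eval y| ≤ M) →
      ∀ y, |y - x₀| ≤ r → |(derivative^[j] P).eval y| ≤ K * (N / s) ^ j * M := by
  induction j with
  | zero =>
    refine ⟨1, one_pos, fun P N M x₀ r s _ _ hs _ hP y hy => ?_⟩
    simpa using hP y (by linarith)
  | succ j ih =>
    obtain ⟨K, hK, h⟩ := ih
    refine ⟨K * 2 ^ (j + 1) * 8, by positivity, fun P N M x₀ r s hN hN1 hs hM hP y hy => ?_⟩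
    have hN0 : (0 : ℝ) < N := by exact_mod_cast hN1
    rw [Function.iterate_succ_apply']
    have h1 := h P N M x₀ (r + s / 2) (s / 2) hN hN1 (by positivity) hM
      (fun y hy => hP y (by linarith))
    refine (abs_derivative_eval_le_bernstein (natDegree_iterate_derivative_le hN j) hN1
      (r := s / 2) (by positivity) (M := K * (N / (s / 2)) ^ j * M) (by positivity)
      fun w hw => h1 w ?_).trans (le_of_eq ?_)
    · calc |w - x₀| = |(w - y) + (y - x₀)| := by ring_nf
        _ ≤ |w - y| + |y - x₀| := abs_add_le _ _
        _ ≤ _ := by linarith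
    · have e1 : (N : ℝ) / (s / 2) = N / s * 2 := by field_simp
      rw [mul_div_assoc, e1, mul_pow]
      ring

lemma abs_eval_sub_le_of_abs_derivative_le {P : ℝ[X]} {J : Set ℝ} (hJ : Convex ℝ J) {L : ℝ}
    (h : ∀ x ∈ J, |P.derivative.eval x| ≤ L) {x y : ℝ} (hx : x ∈ J) (hy : y ∈ J) :
    |P.eval y - P.eval x| ≤ L * |y - x| :=
  hJ.norm_image_sub_le_of_norm_deriv_le (f := fun t => P.eval t)
    (fun t _ => P.differentiableAt) (fun t ht => by simpa using h t ht) hx hy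

/-- A polynomial that vanishes at `1` and is dominated by `A √(1 - x)` near `1` has derivative
`O(N A)` there. -/
lemma abs_derivative_eval_le_of_abs_eval_le_sqrt {Q : ℝ[X]} {N : ℕ} (hN : Q.natDegree ≤ N)
    (hN1 : 1 ≤ N) {A δ : ℝ} (hA : 0 < A) (hδ : 0 < δ)
    (hQ : ∀ x ∈ Icc (1 - δ) 1, |Q.eval x| ≤ A * √(1 - x)) :
    ∀ x ∈ Icc (1 - δ / 4) 1, |Q.derivative.eval x| ≤ 48 * N / √δ * A := by
  have hN0 : (0 : ℝ) < N := by exact_mod_cast hN1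
  have hroot : Q.IsRoot 1 := by
    have := hQ 1 ⟨by linarith, le_rfl⟩
    simpa using this
  obtain ⟨q, rfl⟩ := dvd_iff_isRoot.2 hroot
  rcases eq_or_ne q 0 with rfl | hq0
  · intro x _
    simp only [mul_zero, derivative_zero, eval_zero, abs_zero]
    positivity
  have hqdeg : q.natDegree ≤ N := by
    rw [natDegree_mul (X_sub_C_ne_zero 1) hq0] at hN
    omega
  -- With `x = 1 - v²` and `Q = (X - 1) q`, one has `|Q| = |v| |B(v)|`, so the square-root
  -- hypothesis says exactly that `B` is bounded. The point `x = 1` is now the centre `v = 0`, where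
  -- Bernstein's inequality applies.
  set B : ℝ[X] := X * q.comp (1 - X ^ 2) with hB
  have hBe : ∀ v, B.eval v = v * q.eval (1 - v ^ 2) := by intro v; simp [hB]
  have hBdeg : B.natDegree ≤ 3 * N := by
    have h2 : (1 - X ^ 2 : ℝ[X]).natDegree ≤ 2 := by compute_degree
    have h3 : (q.comp (1 - X ^ 2)).natDegree ≤ N * 2 :=
      natDegree_comp_le.trans (Nat.mul_le_mul hqdeg h2)
    have h4 := natDegree_mul_le (p := X) (q := q.comp (1 - X ^ 2))
    rw [natDegree_X] at h4
    rw [hB]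
    omega
  have hsδ : 0 < √δ := Real.sqrt_pos.2 hδ
  have hBb : ∀ v : ℝ, |v| ≤ √δ → |B.eval v| ≤ A := by
    intro v hv
    rcases eq_or_ne v 0 with rfl | hv0
    · simp [hBe, hA.le]
    have hv2 : v ^ 2 ≤ δ := by
      rw [← sq_abs, ← Real.sq_sqrt hδ.le]
      gcongr
    have h := hQ (1 - v ^ 2) ⟨by linarith, by nlinarith [sq_nonneg v]⟩
    have e1 : (1 : ℝ) - (1 - v ^ 2) = v ^ 2 := by ring
    rw [e1, Real.sqrt_sq_eq_abs, eval_mul, abs_mul] at h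
    have e2 : |eval (1 - v ^ 2) (X - C (1 : ℝ))| = |v| * |v| := by
      simp only [eval_sub, eval_X, eval_C, sub_sub_cancel_left, abs_neg, abs_pow]
      ring
    rw [e2] at h
    rw [hBe, abs_mul]
    have hv' : 0 < |v| := abs_pos.2 hv0
    nlinarith
  set L := 48 * N / √δ * A with hL
  have hB' : ∀ v ∈ Icc (-(√δ / 2)) (√δ / 2), |B.derivative.eval v| ≤ L := by
    intro v hv
    refine (abs_derivative_eval_le_bernstein hBdeg (by omega) (r := √δ / 2) (by positivity) hA
      fun y hy => hBb y ?_).trans (le_of_eq ?_)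
    · have := abs_le.2 hv
      calc |y| = |(y - v) + v| := by ring_nf
        _ ≤ |y - v| + |v| := abs_add_le _ _
        _ ≤ _ := by linarith
    · rw [hL]
      push_cast
      field_simp
      norm_num
  have hL0 : 0 ≤ L := by positivity
  intro x hx
  set v := √(1 - x) with hv
  have hv0 : 0 ≤ v := Real.sqrt_nonneg _
  have hv2 : v ^ 2 = 1 - x := Real.sq_sqrt (by linarith [hx.2])
  have hvδ : v ≤ √δ / 2 := by
    have e4 : √δ / 2 = √(δ / 4) := by
      rw [Real.sqrt_div hδ.le, show (4 : ℝ) = 2 ^ 2 by norm_num, Real.sqrt_sq (by norm_num)]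
    rw [e4]
    exact Real.sqrt_le_sqrt (by linarith [hx.1])
  have hvm : v ∈ Icc (-(√δ / 2)) (√δ / 2) := ⟨by linarith, hvδ⟩
  have hx' : 1 - v ^ 2 = x := by linarith
  have hBd : B.derivative.eval v = q.eval x + 2 * (x - 1) * q.derivative.eval x := by
    rw [hB]
    simp only [derivative_mul, derivative_X, derivative_comp, derivative_sub, derivative_one,
      derivative_X_pow, eval_add, eval_mul, eval_comp, eval_sub, eval_one, eval_pow, eval_X,
      eval_C, eval_zero, hx']
    simp only [Nat.cast_ofNat]
    have : x - 1 = -v ^ 2 := by linarith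
    rw [this]
    ring
  -- For `v ≠ 0`, `q(x) = B(v)/v` with `B(0) = 0`, so the mean value inequality applies; for `v =
  -- 0`, `q(1) = B'(0)`.
  have hq : |q.eval x| ≤ L := by
    rcases eq_or_ne v 0 with h0 | h0
    · have hx1 : x = 1 := by rw [h0] at hx'; linarith
      have := hB' v hvm
      rw [hBd, hx1] at this
      simpa [hx1] using this
    · have h1 := abs_eval_sub_le_of_abs_derivative_le (convex_Icc _ _) hB'
        (x := 0) ⟨by linarith, by linarith⟩ hvm
      rw [hBe, hBe, hx', zero_mul, sub_zero, sub_zero, abs_mul] at h1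
      have hv' : 0 < |v| := abs_pos.2 h0
      nlinarith
  have hQd : ((X - C 1) * q).derivative.eval x = (q.eval x + B.derivative.eval v) / 2 := by
    rw [hBd]
    simp only [derivative_mul, derivative_sub, derivative_X, derivative_C, eval_add, eval_mul,
      eval_sub, eval_one, eval_X, eval_C, eval_zero]
    ring
  rw [hQd, abs_div, abs_two, div_le_iff₀ two_pos]
  exact (abs_add_le _ _).trans (by linarith [hB' v hvm])

/-- A bound for a polynomial off a short gap extends to the gap. -/
lemma abs_eval_le_two_mul_of_gap {Q : ℝ[X]} {J : Set ℝ} (hJ : Convex ℝ J) {A L : ℝ} (hA : 0 < A)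
    (hd : ∀ M : ℝ, 0 < M → (∀ x ∈ Icc (-1 : ℝ) 1, |Q.eval x| ≤ M) →
      ∀ x ∈ J, |Q.derivative.eval x| ≤ L * M)
    (hlen : ∀ x ∈ J, ∀ y ∈ J, L * |x - y| ≤ 1 / 2)
    (hcover : ∀ x ∈ Icc (-1 : ℝ) 1, |Q.eval x| ≤ A ∨ x ∈ J)
    {y : ℝ} (hy : y ∈ J) (hyA : |Q.eval y| ≤ A) :
    ∀ x ∈ Icc (-1 : ℝ) 1, |Q.eval x| ≤ 2 * A := by
  obtain ⟨x₀, hx₀, hmax⟩ := isCompact_Icc.exists_isMaxOn (nonempty_Icc.2 (by norm_num))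
    (f := fun x => |Q.eval x|) (s := Icc (-1 : ℝ) 1) (by fun_prop)
  have hmax' : ∀ x ∈ Icc (-1 : ℝ) 1, |Q.eval x| ≤ |Q.eval x₀| := fun x hx => hmax hx
  suffices h : |Q.eval x₀| ≤ 2 * A from fun x hx => (hmax' x hx).trans h
  rcases hcover x₀ hx₀ with h | h
  · linarith
  by_contra! hcon
  have hpos : 0 < |Q.eval x₀| := by linarith
  -- The derivative bound is used with the maximum of `|Q|` itself as `M`: across the gap `Q` varies
  -- by at most half its maximum, so the maximum is at most twice the value at `y`.
  have h1 := abs_eval_sub_le_of_abs_derivative_le hJ (hd _ hpos hmax') hy h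
  have h2 := mul_le_mul_of_nonneg_right (hlen x₀ h y hy) hpos.le
  have h3 := abs_sub_abs_le_abs_sub (Q.eval x₀) (Q.eval y)
  nlinarith

/-- Bernstein's inequality on radius `δ/2` bounds the derivative by `16N/δ` times the maximum; the
half-width `δ/(64N)` is chosen to make the variation across the gap at most half the maximum. -/
lemma abs_eval_le_of_gap_interior {Q : ℝ[X]} {N : ℕ} (hN : Q.natDegree ≤ N)
    (hN1 : 1 ≤ N) {A δ ξ : ℝ} (hA : 0 < A) (hδ : 0 < δ) (h1 : -1 ≤ ξ - δ) (h2 : ξ + δ ≤ 1)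
    (hQ : ∀ x ∈ Icc (-1 : ℝ) 1, δ / (64 * N) ≤ |x - ξ| → |Q.eval x| ≤ A) :
    ∀ x ∈ Icc (-1 : ℝ) 1, |Q.eval x| ≤ 2 * A := by
  have hN0 : (0 : ℝ) < N := by exact_mod_cast hN1
  have hN1' : (1 : ℝ) ≤ N := by exact_mod_cast hN1
  have hgap : 0 < δ / (64 * N) := by positivity
  have hgap2 : δ / (64 * N) ≤ δ / 64 := by gcongr; linarith
  refine abs_eval_le_two_mul_of_gap (convex_Icc (ξ - δ / (64 * N)) (ξ + δ / (64 * N))) hA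
    (L := 16 * N / δ) ?_ ?_ ?_ (y := ξ + δ / (64 * N)) ?_ ?_
  · intro M hM hb x hx
    refine (abs_derivative_eval_le_bernstein hN hN1 (r := δ / 2) (by positivity) hM
      fun y hy => hb y ?_).trans (le_of_eq ?_)
    · rw [abs_le] at hy
      constructor <;> linarith [hx.1, hx.2, hy.1, hy.2]
    · field_simp
      norm_num
  · intro x hx y hy
    have : |x - y| ≤ 2 * (δ / (64 * N)) := abs_le.2 ⟨by linarith [hx.1, hy.2], by linarith [hx.2, hy.1]⟩
    calc 16 * N / δ * |x - y| ≤ 16 * N / δ * (2 * (δ / (64 * N))) := by gcongr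
      _ = 1 / 2 := by field_simp; norm_num
  · intro x hx
    rcases le_total (δ / (64 * N)) |x - ξ| with h | h
    · exact Or.inl (hQ x hx h)
    · rw [abs_le] at h
      exact Or.inr ⟨by linarith [h.1], by linarith [h.2]⟩
  · exact ⟨by linarith, le_rfl⟩
  · refine hQ _ ⟨by linarith, by linarith⟩ ?_
    rw [add_sub_cancel_left]
    exact le_abs_self _

/-- The same argument with Markov's constant `2N²` on `[-1,1]`, which dictates the width `1/(4N²)`.
-/
lemma abs_eval_le_of_gap_endpoint {Q : ℝ[X]} {N : ℕ} (hN : Q.natDegree ≤ N)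
    (hN1 : 1 ≤ N) {A ξ : ℝ} (hA : 0 < A) (hξ : ξ = 1 ∨ ξ = -1)
    (hQ : ∀ x ∈ Icc (-1 : ℝ) 1, 1 / (4 * N ^ 2) ≤ |x - ξ| → |Q.eval x| ≤ A) :
    ∀ x ∈ Icc (-1 : ℝ) 1, |Q.eval x| ≤ 2 * A := by
  have hN0 : (0 : ℝ) < N := by exact_mod_cast hN1
  have hN1' : (1 : ℝ) ≤ N := by exact_mod_cast hN1
  set g : ℝ := 1 / (4 * N ^ 2) with hg
  have hgap : 0 < g := by positivity
  have hgap2 : g ≤ 1 := by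
    rw [hg, div_le_one (by positivity)]
    nlinarith
  obtain ⟨a, b, hab, ha, hb, hy, hJ⟩ : ∃ a b : ℝ, b - a = g ∧ -1 ≤ a ∧ b ≤ 1 ∧
      (∃ y ∈ Icc a b, |y - ξ| = g) ∧
      ∀ x ∈ Icc (-1 : ℝ) 1, |x - ξ| ≤ g → x ∈ Icc a b := by
    rcases hξ with rfl | rfl
    · refine ⟨1 - g, 1, by ring, by linarith, le_rfl, ⟨1 - g, ⟨le_rfl, by linarith⟩, ?_⟩, ?_⟩
      · rw [sub_sub_cancel_left, abs_neg, abs_of_pos hgap]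
      · intro x hx h
        exact ⟨by linarith [(abs_le.1 h).1], hx.2⟩
    · refine ⟨-1, -1 + g, by ring, le_rfl, by linarith, ⟨-1 + g, ⟨by linarith, le_rfl⟩, ?_⟩, ?_⟩
      · rw [add_sub_cancel_left, abs_of_pos hgap]
      · intro x hx h
        exact ⟨hx.1, by linarith [(abs_le.1 h).2]⟩
  obtain ⟨y, hyJ, hyg⟩ := hy
  refine abs_eval_le_two_mul_of_gap (convex_Icc a b) hA (L := 2 * N ^ 2) ?_ ?_ ?_ hyJ
    (hQ y ⟨by linarith [hyJ.1], by linarith [hyJ.2]⟩ hyg.ge)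
  · intro M hM hbd x hx
    refine (abs_derivative_eval_le_markov hN (by norm_num) hM hbd
      ⟨by linarith [hx.1], by linarith [hx.2]⟩).trans (le_of_eq ?_)
    ring
  · intro x hx y hy
    have : |x - y| ≤ g := abs_le.2 ⟨by linarith [hx.1, hy.2], by linarith [hx.2, hy.1]⟩
    calc 2 * (N : ℝ) ^ 2 * |x - y| ≤ 2 * N ^ 2 * g := by gcongr
      _ = 1 / 2 := by rw [hg]; field_simp; norm_num
  · intro x hx
    rcases le_total g |x - ξ| with h | h
    · exact Or.inl (hQ x hx h)
    · exact Or.inr (hJ x hx h)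

/-! ### From dyadic differences to derivatives of the limit. -/

/-- The mean value inequality for `F l - F k`, in the limit `l → ∞`, shows that increments of `g`
and of `F k` differ by at most `ε k * |y - x|`. Working within a convex set includes one-sided
derivatives at endpoints. -/
lemma hasDerivWithinAt_of_tendsto_uniform {s : Set ℝ} (hs : Convex ℝ s) {F : ℕ → ℝ[X]}
    {g g' : ℝ → ℝ} {ε : ℕ → ℝ} (hε : Tendsto ε atTop (nhds 0))
    (h0 : ∀ x ∈ s, Tendsto (fun k => (F k).eval x) atTop (nhds (g x)))
    (h1 : ∀ k, ∀ x ∈ s, |(F k).derivative.eval x - g' x| ≤ ε k) {x : ℝ} (hx : x ∈ s) :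
    HasDerivWithinAt g (g' x) s x := by
  have key : ∀ k, ∀ y ∈ s, |(g y - g x) - ((F k).eval y - (F k).eval x)| ≤ ε k * |y - x| := by
    intro k y hy
    have hl : ∀ l, |((F l).eval y - (F l).eval x) - ((F k).eval y - (F k).eval x)| ≤
        (ε l + ε k) * |y - x| := by
      intro l
      have := abs_eval_sub_le_of_abs_derivative_le (P := F l - F k) hs (L := ε l + ε k)
        (fun t ht => by
          rw [derivative_sub, eval_sub]
          calc _ = |((F l).derivative.eval t - g' t) - ((F k).derivative.eval t - g' t)| := by
                ring_nf
            _ ≤ _ := (abs_sub _ _).trans (add_le_add (h1 l t ht) (h1 k t ht))) hx hy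
      simp only [eval_sub] at this
      convert this using 2
      ring
    have t1 : Tendsto (fun l => |((F l).eval y - (F l).eval x) - ((F k).eval y - (F k).eval x)|)
        atTop (nhds |(g y - g x) - ((F k).eval y - (F k).eval x)|) :=
      (((h0 y hy).sub (h0 x hx)).sub_const _).abs
    have t2 : Tendsto (fun l => (ε l + ε k) * |y - x|) atTop (nhds ((0 + ε k) * |y - x|)) :=
      (hε.add_const _).mul_const _
    simpa using le_of_tendsto_of_tendsto' t1 t2 hl
  rw [hasDerivWithinAt_iff_isLittleO, isLittleO_iff]
  intro c hc
  obtain ⟨k, hk⟩ := (hε.eventually (gt_mem_nhds (show (0 : ℝ) < c / 3 by positivity))).exists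
  have hF := (F k).hasDerivAt x |>.hasDerivWithinAt (s := s)
  rw [hasDerivWithinAt_iff_isLittleO, isLittleO_iff] at hF
  filter_upwards [hF (show (0 : ℝ) < c / 3 by positivity), self_mem_nhdsWithin] with y hy hys
  have a1 := key k y hys
  have a2 := h1 k x hx
  simp only [Real.norm_eq_abs, smul_eq_mul] at hy ⊢
  have e : g y - g x - (y - x) * g' x = ((g y - g x) - ((F k).eval y - (F k).eval x)) +
      ((F k).eval y - (F k).eval x - (y - x) * (F k).derivative.eval x) +
      (y - x) * ((F k).derivative.eval x - g' x) := by ring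
  rw [e]
  refine (abs_add_three _ _ _).trans ?_
  rw [abs_mul]
  nlinarith [abs_nonneg (y - x)]

/-- If the dyadic differences `p (2 n) - p n` have derivatives of size `n ^ e` with `e < 0`, then
the derivatives of `p n` approximate those of the limit of `p` at the same rate. -/
lemma exists_abs_iteratedDerivWithin_sub_le {a b : ℝ} (hab : a < b) {p : ℕ → ℝ[X]} {f : ℝ → ℝ}
    (hf : ContinuousOn f (Icc a b)) {m n₀ : ℕ} (hn₀ : 1 ≤ n₀) {C e : ℝ} (he : e < 0) {ξ : ℝ}
    (hlim : ∀ x ∈ Icc a b, x ≠ ξ → Tendsto (fun n => (p n).eval x) atTop (nhds (f x)))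
    (h : ∀ j ≤ m, ∀ n ≥ n₀, ∀ x ∈ Icc a b,
      |(derivative^[j] (p (2 * n) - p n)).eval x| ≤ C * (n : ℝ) ^ e) :
    ∃ C' : ℝ, ∀ n ≥ n₀, ∀ x ∈ Icc a b,
      |iteratedDerivWithin m f (Icc a b) x - (derivative^[m] (p n)).eval x| ≤ C' * (n : ℝ) ^ e := by
  -- Sum of the geometric series of ratio `2^e` formed by the steps from `2^k n` to `2^(k+1) n`.
  refine ⟨C / (1 - 2 ^ e), fun n hn => ?_⟩
  set r : ℝ := 2 ^ e with hr
  have hr0 : 0 < r := by positivity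
  have hr1 : r < 1 := Real.rpow_lt_one_of_one_lt_of_neg one_lt_two he
  set P : ℕ → ℝ[X] := fun k => p (2 ^ k * n) with hP
  have hstep : ∀ j ≤ m, ∀ x ∈ Icc a b, ∀ k,
      dist ((derivative^[j] (P k)).eval x) ((derivative^[j] (P (k + 1))).eval x) ≤
        C * (n : ℝ) ^ e * r ^ k := by
    intro j hj x hx k
    have h2 : n₀ ≤ 2 ^ k * n := hn.trans (Nat.le_mul_of_pos_left _ (by positivity))
    have := h j hj (2 ^ k * n) h2 x hx
    rw [iterate_derivative_sub, eval_sub, ← mul_assoc, ← pow_succ'] at this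
    rw [dist_comm, Real.dist_eq]
    refine this.trans (le_of_eq ?_)
    push_cast
    rw [Real.mul_rpow (by positivity) (by positivity), ← Real.rpow_natCast 2 k,
      ← Real.rpow_mul (by norm_num), mul_comm (k : ℝ) e, Real.rpow_mul (by norm_num),
      Real.rpow_natCast, ← hr]
    ring
  have hex : ∀ j x, ∃ y, (j ≤ m ∧ x ∈ Icc a b) →
      Tendsto (fun k => (derivative^[j] (P k)).eval x) atTop (nhds y) := by
    intro j x
    by_cases hjx : j ≤ m ∧ x ∈ Icc a b
    · obtain ⟨y, hy⟩ := cauchySeq_tendsto_of_complete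
        (cauchySeq_of_le_geometric r _ hr1 (hstep j hjx.1 x hjx.2))
      exact ⟨y, fun _ => hy⟩
    · exact ⟨0, fun h => absurd h hjx⟩
  choose g hg using hex
  have hunif : ∀ j ≤ m, ∀ k, ∀ x ∈ Icc a b,
      |(derivative^[j] (P k)).eval x - g j x| ≤ C * (n : ℝ) ^ e * r ^ k / (1 - r) :=
    fun j hj k x hx =>
      dist_le_of_le_geometric_of_tendsto r _ hr1 (hstep j hj x hx) (hg j x ⟨hj, hx⟩) k
  have hε : Tendsto (fun k => C * (n : ℝ) ^ e * r ^ k / (1 - r)) atTop (nhds 0) := by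
    simpa using ((tendsto_pow_atTop_nhds_zero_of_lt_one hr0.le hr1).const_mul
      (C * (n : ℝ) ^ e)).div_const (1 - r)
  have hsub : Tendsto (fun k => 2 ^ k * n) atTop atTop :=
    (tendsto_pow_atTop_atTop_of_one_lt (one_lt_two)).atTop_mul_const' (by omega)
  have hg0cont : ContinuousOn (g 0) (Icc a b) := by
    have : TendstoUniformlyOn (fun k x => (P k).eval x) (g 0) atTop (Icc a b) := by
      rw [Metric.tendstoUniformlyOn_iff]
      intro δ hδ
      filter_upwards [hε.eventually (gt_mem_nhds hδ)] with k hk x hx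
      rw [dist_comm]
      exact (hunif 0 (Nat.zero_le _) k x hx).trans_lt hk
    exact this.continuousOn (Frequently.of_forall fun k => (P k).continuous.continuousOn)
  -- Convergence to `f` is not assumed at `ξ`; there the identity follows from continuity of both
  -- sides and density.
  have hg0 : EqOn (g 0) f (Icc a b) := by
    refine EqOn.of_subset_closure (s := Ioo a b ∩ {ξ}ᶜ) ?_ hg0cont hf
      (inter_subset_left.trans Ioo_subset_Icc_self) ?_
    · intro x hx
      have hxI := Ioo_subset_Icc_self hx.1
      exact tendsto_nhds_unique (hg 0 x ⟨Nat.zero_le _, hxI⟩)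
        ((hlim x hxI hx.2).comp hsub)
    · rw [← closure_Ioo hab.ne]
      exact closure_minimal ((dense_compl_singleton ξ).open_subset_closure_inter isOpen_Ioo)
        isClosed_closure
  have hder : ∀ j < m, ∀ x ∈ Icc a b, HasDerivWithinAt (g j) (g (j + 1) x) (Icc a b) x := by
    intro j hj x hx
    refine hasDerivWithinAt_of_tendsto_uniform (convex_Icc a b) (F := fun k => derivative^[j] (P k))
      hε (fun y hy => hg j y ⟨hj.le, hy⟩) (fun k y hy => ?_) hx
    rw [← Function.iterate_succ_apply' (f := derivative)]
    exact hunif (j + 1) hj k y hy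
  have hiter : ∀ j ≤ m, EqOn (iteratedDerivWithin j f (Icc a b)) (g j) (Icc a b) := by
    intro j
    induction j with
    | zero =>
      intro _ x hx
      rw [iteratedDerivWithin_zero]
      exact (hg0 hx).symm
    | succ j ih =>
      intro hj x hx
      rw [iteratedDerivWithin_succ, derivWithin_congr (ih (by omega)) (ih (by omega) hx)]
      exact (hder j hj x hx).derivWithin (uniqueDiffOn_Icc hab x hx)
  intro x hx
  have := hunif m le_rfl 0 x hx
  rw [hiter m le_rfl hx, abs_sub_comm]
  simp only [hP, pow_zero, one_mul, mul_one] at this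
  exact this.trans (le_of_eq (by ring))

/-! ### Interpolation error of Cauchy kernels. -/

open MeasureTheory

section Error
variable {E : Type*} [NormedAddCommGroup E] [NormedSpace ℝ E]

/-- The error at `x` of interpolating `F` at the Chebyshev–Lobatto points. -/
noncomputable def lobattoError (n : ℕ) (F : ℝ → E) (x : ℝ) : E :=
  F x - ∑ j ∈ Finset.range (n + 1),
    (Lagrange.basis (Finset.range (n + 1)) (Chebyshev.node n) j).eval x • F (Chebyshev.node n j)

lemma lobattoError_eq (f : ℝ → ℝ) (n : ℕ) (x : ℝ) :
    lobattoError n f x = f x - (chebInterp f n).eval x := by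
  simp [lobattoError, chebInterp, Lagrange.interpolate_apply, eval_finsetSum, mul_comm]

lemma lobattoError_congr {n : ℕ} {F G : ℝ → E} {x : ℝ} (hx : F x = G x)
    (h : ∀ j ∈ Finset.range (n + 1), F (Chebyshev.node n j) = G (Chebyshev.node n j)) :
    lobattoError n F x = lobattoError n G x := by
  unfold lobattoError
  rw [hx, Finset.sum_congr rfl fun j hj => by rw [h j hj]]

lemma lobattoError_congr_of_eqOn {n : ℕ} {F G : ℝ → E} {x : ℝ} (hx : x ∈ Icc (-1 : ℝ) 1)
    (h : EqOn F G (Icc (-1) 1)) : lobattoError n F x = lobattoError n G x :=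
  lobattoError_congr (h hx) fun _ _ => h Chebyshev.node_mem_Icc

lemma lobattoError_add (n : ℕ) (F G : ℝ → E) (x : ℝ) :
    lobattoError n (fun y => F y + G y) x = lobattoError n F x + lobattoError n G x := by
  simp only [lobattoError, smul_add, Finset.sum_add_distrib]
  abel

lemma lobattoError_sub (n : ℕ) (F G : ℝ → E) (x : ℝ) :
    lobattoError n (fun y => F y - G y) x = lobattoError n F x - lobattoError n G x := by
  simp only [lobattoError, smul_sub, Finset.sum_sub_distrib]
  abel

lemma lobattoError_sum {ι : Type*} (s : Finset ι) (n : ℕ) (F : ι → ℝ → E) (x : ℝ) :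
    lobattoError n (fun y => ∑ i ∈ s, F i y) x = ∑ i ∈ s, lobattoError n (F i) x := by
  simp only [lobattoError, Finset.smul_sum, Finset.sum_sub_distrib]
  rw [Finset.sum_comm]

lemma lobattoError_const_mul {𝕜 : Type*} [RCLike 𝕜] (n : ℕ) (c : 𝕜) (F : ℝ → 𝕜) (x : ℝ) :
    lobattoError n (fun y => c * F y) x = c * lobattoError n F x := by
  simp only [lobattoError, mul_sub, Finset.mul_sum, mul_smul_comm]

lemma lobattoError_ofReal (n : ℕ) (F : ℝ → ℝ) (x : ℝ) :
    lobattoError n (fun y => (F y : ℂ)) x = ((lobattoError n F x : ℝ) : ℂ) := by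
  simp [lobattoError]

lemma lobattoError_integral {α : Type*} [MeasurableSpace α] {μ : Measure α} {K : α → ℝ → ℝ}
    (n : ℕ) {x : ℝ} (hx : x ∈ Icc (-1 : ℝ) 1)
    (hK : ∀ y ∈ Icc (-1 : ℝ) 1, Integrable (fun t => K t y) μ) :
    lobattoError n (fun y => ∫ t, K t y ∂μ) x = ∫ t, lobattoError n (K t) x ∂μ := by
  unfold lobattoError
  rw [integral_sub (hK x hx), integral_finsetSum]
  · simp_rw [integral_smul]
  · intro j _
    exact (hK _ Chebyshev.node_mem_Icc).const_mul _
  · exact integrable_finsetSum _ fun j _ => (hK _ Chebyshev.node_mem_Icc).const_mul _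

lemma lobattoError_node {n : ℕ} (F : ℝ → E) {j : ℕ} (hj : j ∈ Finset.range (n + 1)) :
    lobattoError n F (Chebyshev.node n j) = 0 := by
  have hinj := (Chebyshev.strictAntiOn_node n).injOn
  rw [lobattoError, Finset.sum_eq_single_of_mem j hj, Lagrange.eval_basis_self hinj hj, one_smul,
    sub_self]
  intro i hi hij
  rw [Lagrange.eval_basis_of_ne hij hj, zero_smul]

lemma lobattoError_eval_eq_zero {n : ℕ} {P : ℝ[X]} (hP : P.natDegree ≤ n) (x : ℝ) :
    lobattoError n (fun y => P.eval y) x = 0 := by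
  have hdeg : P.degree < (Finset.range (n + 1)).card := by
    rw [Finset.card_range]
    exact lt_of_le_of_lt (natDegree_le_iff_degree_le.1 hP) (by exact_mod_cast Nat.lt_succ_self n)
  have h := Lagrange.eq_interpolate (Chebyshev.strictAntiOn_node n).injOn hdeg
  rw [lobattoError_eq, chebInterp]
  exact sub_eq_zero.2 (congrArg (eval x) h)

lemma lobattoError_complex_eval_eq_zero {n : ℕ} {P : ℂ[X]} (hP : P.natDegree ≤ n) (x : ℝ) :
    lobattoError n (fun y : ℝ => P.eval (y : ℂ)) x = 0 := by
  simp_rw [eval_eq_sum_range]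
  rw [lobattoError_sum]
  refine Finset.sum_eq_zero fun i hi => ?_
  have hi' : i ≤ n := (Nat.lt_succ_iff.1 (Finset.mem_range.1 hi)).trans hP
  have h := lobattoError_eval_eq_zero (n := n) (P := X ^ i) ((natDegree_X_pow_le i).trans hi') x
  have h2 := lobattoError_ofReal n (fun y => eval y (X ^ i : ℝ[X])) x
  rw [h] at h2
  simp only [eval_pow, eval_X, Complex.ofReal_pow, Complex.ofReal_zero] at h2
  rw [lobattoError_const_mul, h2, mul_zero]

end Error

/-- The polynomial `(X ^ 2 - 1) U_{n-1}`, whose zeros are the Chebyshev–Lobatto points. -/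
noncomputable def lobattoNodal (n : ℕ) : ℂ[X] := (X ^ 2 - 1) * Chebyshev.U ℂ (n - 1)

lemma natDegree_lobattoNodal_le {n : ℕ} (hn : 1 ≤ n) : (lobattoNodal n).natDegree ≤ n + 1 := by
  have h1 : (X ^ 2 - 1 : ℂ[X]).natDegree ≤ 2 := by compute_degree
  have h2 : (Chebyshev.U ℂ (n - 1)).natDegree ≤ n - 1 := by
    rw [Chebyshev.natDegree_U]
    omega
  exact natDegree_mul_le.trans (by omega)

lemma eval_lobattoNodal_cos (n : ℕ) (θ : ℂ) :
    (lobattoNodal n).eval (Complex.cos θ) = -(Complex.sin θ * Complex.sin (n * θ)) := by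
  have h := Chebyshev.U_complex_cos θ (n - 1)
  push_cast at h
  rw [sub_add_cancel] at h
  rw [← h, lobattoNodal]
  simp only [eval_mul, eval_sub, eval_pow, eval_X, eval_one]
  have := Complex.sin_sq_add_cos_sq θ
  linear_combination (eval (Complex.cos θ) (Chebyshev.U ℂ (↑n - 1))) * this

lemma eval_lobattoNodal_node {n : ℕ} (hn : 1 ≤ n) (j : ℕ) :
    (lobattoNodal n).eval (Chebyshev.node n j : ℂ) = 0 := by
  have hn0 : (n : ℂ) ≠ 0 := by exact_mod_cast (by omega : n ≠ 0)
  rw [Chebyshev.node, Complex.ofReal_cos, eval_lobattoNodal_cos]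
  have : (n : ℂ) * ((j * Real.pi / n : ℝ) : ℂ) = j * Real.pi := by
    push_cast
    field_simp
  rw [this, Complex.sin_nat_mul_pi, mul_zero, neg_zero]

/-- The polynomial `ω(z) h - h(z) ω` vanishes at `z`, so dividing it by `y - z` leaves degree at
most `n`, which interpolation reproduces. What remains is a multiple of `ω(y)/(y - z)`, zero at
every node, hence equal to its own error. -/
lemma lobattoError_div {n : ℕ} (hn : 1 ≤ n) {h : ℂ[X]} (hh : h.natDegree ≤ n + 1) {z : ℂ}
    (hz : (lobattoNodal n).eval z ≠ 0) {x : ℝ} (hxz : (x : ℂ) ≠ z) :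
    lobattoError n (fun y : ℝ => h.eval (y : ℂ) / (y - z)) x =
      h.eval z * (lobattoNodal n).eval (x : ℂ) / ((lobattoNodal n).eval z * (x - z)) := by
  set w := lobattoNodal n with hw
  set P : ℂ[X] := C (w.eval z) * h - C (h.eval z) * w with hP
  have hroot : P.IsRoot z := by simp [hP, mul_comm]
  obtain ⟨q, hq⟩ := dvd_iff_isRoot.2 hroot
  have hPdeg : P.natDegree ≤ n + 1 :=
    (natDegree_sub_le _ _).trans (max_le ((natDegree_C_mul_le _ _).trans hh)
      ((natDegree_C_mul_le _ _).trans (natDegree_lobattoNodal_le hn)))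
  have hqdeg : q.natDegree ≤ n := by
    rcases eq_or_ne q 0 with rfl | hq0
    · simp
    · rw [hq, natDegree_mul (X_sub_C_ne_zero z) hq0, natDegree_X_sub_C] at hPdeg
      omega
  have key : ∀ y : ℝ, (y : ℂ) ≠ z → h.eval (y : ℂ) / (y - z) =
      (w.eval z)⁻¹ * q.eval (y : ℂ) + h.eval z * w.eval (y : ℂ) / (w.eval z * (y - z)) := by
    intro y hy
    have hyz : (y : ℂ) - z ≠ 0 := sub_ne_zero.2 hy
    have h1 := congrArg (eval (y : ℂ)) hq
    simp only [hP, eval_sub, eval_mul, eval_C, eval_X] at h1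
    field_simp
    linear_combination h1
  have hnode : ∀ j, ((Chebyshev.node n j : ℝ) : ℂ) ≠ z := by
    intro j hj
    exact hz (hj ▸ eval_lobattoNodal_node hn j)
  rw [lobattoError_congr (G := fun y : ℝ => (w.eval z)⁻¹ * q.eval (y : ℂ) +
    h.eval z * w.eval (y : ℂ) / (w.eval z * (y - z))) (key x hxz) fun j _ => key _ (hnode j),
    lobattoError_add,
    lobattoError_const_mul, lobattoError_complex_eval_eq_zero hqdeg, mul_zero, zero_add,
    lobattoError, Finset.sum_eq_zero, sub_zero]
  intro j _
  rw [eval_lobattoNodal_node hn, mul_zero, zero_div, smul_zero]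

lemma norm_eval_lobattoNodal_le (n : ℕ) {x : ℝ} (hx : x ∈ Icc (-1 : ℝ) 1) :
    ‖(lobattoNodal n).eval (x : ℂ)‖ ≤ √(1 - x ^ 2) := by
  have h1 : Real.cos (Real.arccos x) = x := Real.cos_arccos hx.1 hx.2
  have h2 := eval_lobattoNodal_cos n (Real.arccos x)
  rw [← Complex.ofReal_cos, h1] at h2
  rw [h2, norm_neg, norm_mul, ← Complex.ofReal_sin, Real.sin_arccos]
  have e : Complex.sin (n * (Real.arccos x : ℂ)) = ((Real.sin (n * Real.arccos x) : ℝ) : ℂ) := by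
    push_cast
    rfl
  rw [e, Complex.norm_real, Complex.norm_real, Real.norm_of_nonneg (Real.sqrt_nonneg _)]
  exact mul_le_of_le_one_right (Real.sqrt_nonneg _) (Real.abs_sin_le_one _)

lemma sinh_abs_im_le_norm_sin (w : ℂ) : Real.sinh |w.im| ≤ ‖Complex.sin w‖ := by
  have h : Complex.normSq (Complex.sin w) = Real.sin w.re ^ 2 + Real.sinh w.im ^ 2 := by
    have h1 := Complex.sin_eq w
    have h2 : Complex.sin w = ⟨Real.sin w.re * Real.cosh w.im, Real.cos w.re * Real.sinh w.im⟩ := by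
      rw [h1]
      apply Complex.ext <;> simp [← Complex.ofReal_sin, ← Complex.ofReal_cos,
        ← Complex.ofReal_sinh, ← Complex.ofReal_cosh]
    rw [h2, Complex.normSq_mk]
    have := Real.sin_sq_add_cos_sq w.re
    have := Real.cosh_sq w.im
    nlinarith
  refine le_of_sq_le_sq ?_ (norm_nonneg _)
  rw [← Complex.normSq_eq_norm_sq, h]
  have : Real.sinh |w.im| ^ 2 = Real.sinh w.im ^ 2 := by
    rcases abs_choice w.im with h | h <;> rw [h]
    rw [Real.sinh_neg, neg_sq]
  rw [this]
  nlinarith [sq_nonneg (Real.sin w.re)]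

/-- Since `exp b = sinh b + cosh b ≥ 1 + u`, it suffices to bound `(1 + u)^n - 1` below by its
linear and `M`-th binomial terms; `n ≥ 2M` makes the binomial coefficient at least `(n/2)^M / M!`.
The linear term serves small `nu`, and the power gives decay at infinity as fast as needed. -/
lemma sinh_nat_mul_ge (M : ℕ) (hM : 1 ≤ M) : ∃ c : ℝ, 0 < c ∧ ∀ n : ℕ, 2 * M ≤ n → ∀ b u : ℝ,
    0 < u → 0 ≤ b → u ≤ Real.sinh b → c * (n * u + (n * u) ^ M) ≤ Real.sinh (n * b) := by
  refine ⟨1 / (4 * (2 ^ M * M.factorial)), by positivity, fun n hn b u hu hb hub => ?_⟩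
  have hexp : 1 + u ≤ Real.exp b := by
    have h1 := Real.sinh_add_cosh b
    have h2 := Real.one_le_cosh b
    linarith
  have hsinh : ((1 + u) ^ n - 1) / 2 ≤ Real.sinh (n * b) := by
    rw [Real.sinh_eq, Real.exp_nat_mul]
    have h1 : (1 + u) ^ n ≤ Real.exp b ^ n := pow_le_pow_left₀ (by linarith) hexp n
    have h2 : Real.exp (-(n * b)) ≤ 1 := Real.exp_le_one_iff.2 (by
      have : (0 : ℝ) ≤ n * b := by positivity
      linarith)
    linarith
  have hlin : (n : ℝ) * u ≤ (1 + u) ^ n - 1 := by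
    have := one_add_mul_le_pow (show (-2 : ℝ) ≤ u by linarith) n
    linarith
  have hpow : (n * u) ^ M / (2 ^ M * M.factorial) ≤ (1 + u) ^ n - 1 := by
    have h1 : 1 + (n.choose M : ℝ) * u ^ M ≤ (1 + u) ^ n := by
      rw [add_comm 1 u, add_pow]
      have hsub : ({0, M} : Finset ℕ) ⊆ Finset.range (n + 1) := by
        intro i hi
        simp only [Finset.mem_insert, Finset.mem_singleton] at hi
        rw [Finset.mem_range]
        omega
      refine le_trans (le_of_eq ?_) (Finset.sum_le_sum_of_subset_of_nonneg hsub
        fun i _ _ => by positivity)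
      rw [Finset.sum_pair (by omega)]
      simp [mul_comm]
    have h2 : ((n : ℝ) / 2) ^ M / M.factorial ≤ n.choose M := by
      have h3 := Nat.pow_sub_le_descFactorial n M
      have h4 : (n / 2 : ℝ) ≤ ((n + 1 - M : ℕ) : ℝ) := by
        rw [Nat.cast_sub (by omega)]
        have : (2 * M : ℝ) ≤ n := by exact_mod_cast hn
        push_cast
        linarith
      rw [div_le_iff₀ (by positivity)]
      calc ((n : ℝ) / 2) ^ M ≤ ((n + 1 - M : ℕ) : ℝ) ^ M := by gcongr
        _ ≤ (n.descFactorial M : ℝ) := by exact_mod_cast h3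
        _ = n.choose M * M.factorial := by
          rw [Nat.descFactorial_eq_factorial_mul_choose]
          push_cast
          ring
    calc (n * u) ^ M / (2 ^ M * M.factorial) = ((n : ℝ) / 2) ^ M / M.factorial * u ^ M := by
          rw [mul_pow, div_pow]
          field_simp
      _ ≤ n.choose M * u ^ M := by gcongr
      _ ≤ _ := by linarith
  set D : ℝ := 2 ^ M * M.factorial with hD
  have hD1 : 1 ≤ D := by
    have h1 : (1 : ℝ) ≤ 2 ^ M := one_le_pow₀ (by norm_num)
    have h2 : (1 : ℝ) ≤ M.factorial := by exact_mod_cast Nat.factorial_pos M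
    nlinarith
  have hlin' : n * u / D ≤ (1 + u) ^ n - 1 :=
    (div_le_self (by positivity) hD1).trans hlin
  calc 1 / (4 * D) * (n * u + (n * u) ^ M) = (n * u / D + (n * u) ^ M / D) / 4 := by
        field_simp
    _ ≤ ((1 + u) ^ n - 1) / 2 := by linarith
    _ ≤ _ := hsinh

lemma le_norm_eval_lobattoNodal (M : ℕ) (hM : 1 ≤ M) : ∃ c : ℝ, 0 < c ∧
    ∀ n : ℕ, 2 * M ≤ n → ∀ (θ : ℂ) (u : ℝ), 0 < u → u ≤ Real.sinh |θ.im| →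
      √‖1 - Complex.cos θ ^ 2‖ * (c * (n * u + (n * u) ^ M)) ≤
        ‖(lobattoNodal n).eval (Complex.cos θ)‖ := by
  obtain ⟨c, hc, h⟩ := sinh_nat_mul_ge M hM
  refine ⟨c, hc, fun n hn θ u hu hθ => ?_⟩
  have h1 := h n hn |θ.im| u hu (abs_nonneg _) hθ
  have h2 := sinh_abs_im_le_norm_sin (n * θ)
  have h3 : |((n : ℂ) * θ).im| = n * |θ.im| := by simp [abs_mul]
  rw [h3] at h2
  have h4 : √‖1 - Complex.cos θ ^ 2‖ = ‖Complex.sin θ‖ := by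
    rw [← Complex.sin_sq, norm_pow, Real.sqrt_sq (norm_nonneg _)]
  rw [eval_lobattoNodal_cos, norm_neg, norm_mul, h4]
  exact mul_le_mul_of_nonneg_left (h1.trans h2) (norm_nonneg _)

/-! ### Scaling of integrals and fractional powers as superpositions. -/

lemma integrableOn_Ioi_of_le_rpow {φ : ℝ → ℝ} (hφ : Measurable φ) {p q : ℝ} (hp : -1 < p)
    (hq : q < -1) (h0 : ∀ u, 0 < u → |φ u| ≤ u ^ p) (h1 : ∀ u, 0 < u → |φ u| ≤ u ^ q) :
    IntegrableOn φ (Ioi 0) := by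
  rw [← Ioc_union_Ioi_eq_Ioi (zero_le_one (α := ℝ))]
  refine IntegrableOn.union ?_ ?_
  · have hi : IntegrableOn (fun u : ℝ => u ^ p) (Ioc 0 1) :=
      (intervalIntegrable_iff_integrableOn_Ioc_of_le zero_le_one).1
        (intervalIntegral.intervalIntegrable_rpow' hp)
    exact hi.mono' hφ.aestronglyMeasurable
      ((ae_restrict_iff' measurableSet_Ioc).2 (ae_of_all _ fun u hu => h0 u hu.1))
  · exact (integrableOn_Ioi_rpow_of_lt hq one_pos).mono' hφ.aestronglyMeasurable
      ((ae_restrict_iff' measurableSet_Ioi).2 (ae_of_all _ fun u hu =>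
        h1 u (zero_lt_one.trans hu)))

/-- Substituting `u = l t` extracts `l^(-1-a)` from a fixed integral; the two hypotheses are
integrability at `0` and at infinity. It serves with `l = n`, `κ = 1` for interior singularities and
`l = n²`, `κ = 1/2` for endpoints. -/
lemma exists_abs_integral_le_of_scaling {a κ : ℝ} {M : ℕ} (h0 : -1 < a - κ)
    (h1 : a - κ * M < -1) : ∃ J : ℝ, 0 ≤ J ∧ ∀ (l B : ℝ) (G : ℝ → ℝ), 0 < l →
      (∀ t, 0 < t → |G t| ≤ B * (t ^ a / ((l * t) ^ κ + ((l * t) ^ κ) ^ M))) →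
      |∫ t in Ioi 0, G t| ≤ B * l ^ (-1 - a) * J := by
  set φ : ℝ → ℝ := fun u => u ^ a / (u ^ κ + (u ^ κ) ^ M) with hφ
  have hφi : IntegrableOn φ (Ioi 0) := by
    refine integrableOn_Ioi_of_le_rpow (by fun_prop) h0 h1 (fun u hu => ?_) fun u hu => ?_
    · rw [hφ, abs_of_nonneg (by positivity), Real.rpow_sub hu]
      exact div_le_div_of_nonneg_left (by positivity) (by positivity)
        (le_add_of_nonneg_right (by positivity))
    · rw [hφ, abs_of_nonneg (by positivity), Real.rpow_sub hu, Real.rpow_mul hu.le,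
        Real.rpow_natCast]
      exact div_le_div_of_nonneg_left (by positivity) (by positivity)
        (le_add_of_nonneg_left (by positivity))
  refine ⟨∫ u in Ioi 0, φ u, setIntegral_nonneg measurableSet_Ioi fun u hu => ?_,
    fun l B G hl hG => ?_⟩
  · have : (0 : ℝ) < u := hu
    positivity
  have hscale : ∀ t, 0 < t → t ^ a / ((l * t) ^ κ + ((l * t) ^ κ) ^ M) = l ^ (-a) * φ (l * t) := by
    intro t ht
    rw [hφ]
    simp only
    rw [Real.mul_rpow hl.le ht.le (z := a), Real.rpow_neg hl.le]
    have := Real.rpow_pos_of_pos hl a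
    field_simp
  have hint : IntegrableOn (fun t => B * (l ^ (-a) * φ (l * t))) (Ioi 0) := by
    refine Integrable.const_mul (Integrable.const_mul ?_ _) _
    have := (integrableOn_Ioi_comp_mul_left_iff φ 0 hl).2 (by simpa using hφi)
    exact this
  have hle := norm_integral_le_of_norm_le (f := G) hint
    ((ae_restrict_iff' measurableSet_Ioi).2 (ae_of_all _ fun t ht => by
      rw [← hscale t ht]
      exact hG t ht))
  rw [Real.norm_eq_abs] at hle
  refine hle.trans (le_of_eq ?_)
  rw [integral_const_mul, integral_const_mul, integral_comp_mul_left_Ioi φ 0 hl, mul_zero,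
    smul_eq_mul, show (-1 - a) = -a + -1 by ring, Real.rpow_add hl, Real.rpow_neg_one]
  ring

lemma integrableOn_rpow_mul_pow_div {ρ : ℕ} (hρ : ρ ≠ 0) {s : ℝ} (h0 : 0 < s) (h1 : s < ρ) {w : ℝ}
    (hw : 0 ≤ w) : IntegrableOn (fun t : ℝ => t ^ (s - 1) * (w ^ ρ / (w ^ ρ + t ^ ρ))) (Ioi 0) := by
  rcases hw.eq_or_lt with rfl | hw
  · simp [hρ]
  have hbase : IntegrableOn (fun u : ℝ => u ^ (s - 1) * (1 / (1 + u ^ ρ))) (Ioi 0) := by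
    refine integrableOn_Ioi_of_le_rpow (by fun_prop) (p := s - 1) (q := s - 1 - ρ)
      (by linarith) (by linarith) (fun u hu => ?_) fun u hu => ?_
    · rw [abs_of_nonneg (by positivity)]
      refine mul_le_of_le_one_right (by positivity) ?_
      rw [div_le_one (by positivity)]
      exact le_add_of_nonneg_right (by positivity)
    · rw [abs_of_nonneg (by positivity), Real.rpow_sub hu (s - 1), Real.rpow_natCast, mul_one_div]
      have : 0 < u ^ ρ := by positivity
      gcongr
      linarith
  have h2 := (integrableOn_Ioi_comp_mul_left_iff
    (fun u : ℝ => u ^ (s - 1) * (1 / (1 + u ^ ρ))) 0 (inv_pos.2 hw)).2 (by simpa using hbase)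
  have h3 : IntegrableOn (fun t : ℝ => w ^ (s - 1) *
      ((w⁻¹ * t) ^ (s - 1) * (1 / (1 + (w⁻¹ * t) ^ ρ)))) (Ioi 0) := h2.const_mul _
  refine h3.congr_fun (fun t ht => ?_) measurableSet_Ioi
  have ht : 0 < t := ht
  simp only
  rw [Real.mul_rpow (by positivity) ht.le, Real.inv_rpow hw.le, mul_pow, inv_pow]
  have e1 := Real.rpow_pos_of_pos hw (s - 1)
  have e2 : 0 < w ^ ρ := by positivity
  field_simp

/-- `w ^ s` as a superposition of rational functions of `w ^ ρ`. -/
lemma exists_rpow_eq_integral {ρ : ℕ} (hρ : ρ ≠ 0) {s : ℝ} (h0 : 0 < s) (h1 : s < ρ) :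
    ∃ c : ℝ, ∀ w : ℝ, 0 ≤ w →
      w ^ s = c * ∫ t in Ioi 0, t ^ (s - 1) * (w ^ ρ / (w ^ ρ + t ^ ρ)) := by
  -- The value of the integral at `w = 1`; the substitution `t = w u` reduces every `w > 0` to it.
  set K : ℝ := ∫ u in Ioi 0, u ^ (s - 1) * (1 / (1 + u ^ ρ)) with hK
  have hK0 : 0 < K := by
    have hi := integrableOn_rpow_mul_pow_div hρ h0 h1 zero_le_one
    simp only [one_pow] at hi
    rw [hK, setIntegral_pos_iff_support_of_nonneg_ae _ hi]
    · have : Ioi (0 : ℝ) ⊆ Function.support (fun u : ℝ => u ^ (s - 1) * (1 / (1 + u ^ ρ))) := by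
        intro u hu
        have hu : 0 < u := hu
        exact (show (0 : ℝ) < u ^ (s - 1) * (1 / (1 + u ^ ρ)) by positivity).ne'
      rw [inter_eq_right.2 this]
      simp
    · refine (ae_restrict_iff' measurableSet_Ioi).2 (ae_of_all _ fun u hu => ?_)
      have hu : 0 < u := hu
      exact (show (0 : ℝ) ≤ u ^ (s - 1) * (1 / (1 + u ^ ρ)) by positivity)
  refine ⟨K⁻¹, fun w hw => ?_⟩
  rcases hw.eq_or_lt with rfl | hw
  · simp [hρ, h0.ne']
  have h := integral_comp_mul_left_Ioi
    (fun t : ℝ => t ^ (s - 1) * (w ^ ρ / (w ^ ρ + t ^ ρ))) 0 hw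
  rw [mul_zero, smul_eq_mul] at h
  have h2 : ∫ u in Ioi (0 : ℝ), (w * u) ^ (s - 1) * (w ^ ρ / (w ^ ρ + (w * u) ^ ρ)) =
      w ^ (s - 1) * K := by
    rw [hK, ← integral_const_mul]
    refine setIntegral_congr_fun measurableSet_Ioi fun u hu => ?_
    have hu : 0 < u := hu
    rw [Real.mul_rpow hw.le hu.le, mul_pow]
    have e2 : 0 < w ^ ρ := by positivity
    field_simp
  rw [h2] at h
  have h3 : ∫ t in Ioi 0, t ^ (s - 1) * (w ^ ρ / (w ^ ρ + t ^ ρ)) = w * (w ^ (s - 1) * K) := by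
    rw [h, ← mul_assoc, mul_inv_cancel₀ hw.ne', one_mul]
  rw [h3, Real.rpow_sub_one hw.ne']
  field_simp

/-! ### Errors of the rational kernels. -/

lemma le_sinh_abs_im_of_cos_im (θ : ℂ) : |(Complex.cos θ).im| ≤ Real.sinh |θ.im| := by
  have h : (Complex.cos θ).im = -(Real.sin θ.re * Real.sinh θ.im) := by
    rw [Complex.cos_eq]
    simp [← Complex.ofReal_sin, ← Complex.ofReal_cos, ← Complex.ofReal_sinh, ← Complex.ofReal_cosh]
  have h2 : |Real.sinh θ.im| = Real.sinh |θ.im| := Real.abs_sinh θ.im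
  rw [h, abs_neg, abs_mul, ← h2]
  exact mul_le_of_le_one_left (abs_nonneg _) (Real.abs_sin_le_one _)

/-- From `cosh |Im θ| ≥ 1 + t` follows `sinh² ≥ 2t + t²`. A pole at distance `t` beyond an endpoint
thus acts like one at height `√t`, which is why endpoint singularities converge at twice the rate.
-/
lemma sqrt_le_sinh_abs_im_of_cos_re {θ : ℂ} {t : ℝ} (ht : 0 ≤ t)
    (h : 1 + t ≤ |(Complex.cos θ).re|) : √t ≤ Real.sinh |θ.im| := by
  have h1 : (Complex.cos θ).re = Real.cos θ.re * Real.cosh θ.im := by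
    rw [Complex.cos_eq]
    simp [← Complex.ofReal_sin, ← Complex.ofReal_cos, ← Complex.ofReal_sinh, ← Complex.ofReal_cosh]
  have h2 : 1 + t ≤ Real.cosh |θ.im| := by
    rw [Real.cosh_abs]
    refine h.trans ?_
    rw [h1, abs_mul, abs_of_pos (Real.cosh_pos _)]
    exact mul_le_of_le_one_left (Real.cosh_pos _).le (Real.abs_cos_le_one _)
  have h3 := Real.cosh_sq |θ.im|
  refine Real.sqrt_le_iff.2 ⟨Real.sinh_nonneg_iff.2 (abs_nonneg _), ?_⟩
  nlinarith

lemma norm_lobattoError_div_le {n M : ℕ} {c : ℝ} (hn : 1 ≤ n) (hc : 0 < c)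
    (hlow : ∀ (θ : ℂ) (u : ℝ), 0 < u → u ≤ Real.sinh |θ.im| →
      √‖1 - Complex.cos θ ^ 2‖ * (c * (n * u + (n * u) ^ M)) ≤
        ‖(lobattoNodal n).eval (Complex.cos θ)‖)
    {h : ℂ[X]} (hh : h.natDegree ≤ n + 1) {θ : ℂ} {u A H x : ℝ} (hu : 0 < u)
    (huθ : u ≤ Real.sinh |θ.im|) (hx : x ∈ Icc (-1 : ℝ) 1) (hA : 0 < A)
    (hAle : A ≤ √‖1 - Complex.cos θ ^ 2‖ * ‖(x : ℂ) - Complex.cos θ‖)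
    (hH : ‖h.eval (Complex.cos θ)‖ ≤ H) :
    ‖lobattoError n (fun y : ℝ => h.eval (y : ℂ) / (y - Complex.cos θ)) x‖ ≤
      H * √(1 - x ^ 2) / (A * c * (n * u + (n * u) ^ M)) := by
  have hprod := hA.trans_le hAle
  have hs1 : 0 < √‖1 - Complex.cos θ ^ 2‖ := by
    by_contra! hcon
    have : √‖1 - Complex.cos θ ^ 2‖ = 0 := le_antisymm hcon (Real.sqrt_nonneg _)
    rw [this, zero_mul] at hprod
    exact lt_irrefl _ hprod
  have hs2 : 0 < ‖(x : ℂ) - Complex.cos θ‖ := (pos_iff_pos_of_mul_pos hprod).1 hs1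
  have hn0 : (0 : ℝ) < n := by exact_mod_cast hn
  have hl := hlow θ u hu huθ
  set D := n * u + (n * u) ^ M with hD
  have hD0 : 0 < D := by positivity
  have hωpos : 0 < ‖(lobattoNodal n).eval (Complex.cos θ)‖ := lt_of_lt_of_le (by positivity) hl
  rw [lobattoError_div hn hh (norm_pos_iff.1 hωpos) (sub_ne_zero.1 (norm_pos_iff.1 hs2)),
    norm_div, norm_mul, norm_mul]
  have hω := norm_eval_lobattoNodal_le n hx
  have hH0 : 0 ≤ H := (norm_nonneg _).trans hH
  refine div_le_div₀ (by positivity) (by gcongr) (by positivity) ?_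
  calc A * c * D ≤ (√‖1 - Complex.cos θ ^ 2‖ * ‖(x : ℂ) - Complex.cos θ‖) * c * D := by gcongr
    _ = √‖1 - Complex.cos θ ^ 2‖ * (c * D) * ‖(x : ℂ) - Complex.cos θ‖ := by ring
    _ ≤ _ := by gcongr

/-- Partial fractions split the kernel into simple poles at `ξ ± it`, where the numerator has
modulus `t^j`; by conjugation both poles satisfy the distance bound `A`. -/
lemma abs_lobattoError_interior_kernel_le {n M j : ℕ} {c : ℝ} (hn : 1 ≤ n) (hc : 0 < c)
    (hlow : ∀ (θ : ℂ) (u : ℝ), 0 < u → u ≤ Real.sinh |θ.im| →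
      √‖1 - Complex.cos θ ^ 2‖ * (c * (n * u + (n * u) ^ M)) ≤
        ‖(lobattoNodal n).eval (Complex.cos θ)‖)
    (hj : j ≤ n + 1) {ξ t A x : ℝ} (ht : 0 < t) (hx : x ∈ Icc (-1 : ℝ) 1) (hA : 0 < A)
    (hAle : A ≤ √‖1 - ((ξ : ℂ) + t * Complex.I) ^ 2‖ * ‖(x : ℂ) - ((ξ : ℂ) + t * Complex.I)‖) :
    |lobattoError n (fun y : ℝ => (y - ξ) ^ j / ((y - ξ) ^ 2 + t ^ 2)) x| ≤
      t ^ j / t * √(1 - x ^ 2) / (A * c * (n * t + (n * t) ^ M)) := by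
  set h : ℂ[X] := (X - C (ξ : ℂ)) ^ j with hh
  have hdeg : h.natDegree ≤ n + 1 := by
    rw [hh, natDegree_pow, natDegree_X_sub_C, mul_one]
    exact hj
  set B := t ^ j * √(1 - x ^ 2) / (A * c * (n * t + (n * t) ^ M)) with hB
  have hone : ∀ z : ℂ, z.im = t ∨ z.im = -t → z.re = ξ →
      A ≤ √‖1 - z ^ 2‖ * ‖(x : ℂ) - z‖ →
      ‖lobattoError n (fun y : ℝ => h.eval (y : ℂ) / (y - z)) x‖ ≤ B := by
    intro z hzi hzr hz
    obtain ⟨θ, rfl⟩ := Complex.cos_surjective z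
    have habs : |(Complex.cos θ).im| = t := by
      rcases hzi with h | h <;> simp [h, abs_of_pos ht]
    refine norm_lobattoError_div_le hn hc hlow hdeg ht
      (habs ▸ le_sinh_abs_im_of_cos_im θ) hx hA hz (le_of_eq ?_)
    have e : Complex.cos θ - ξ = (Complex.cos θ).im * Complex.I := by
      apply Complex.ext <;> simp [hzr]
    rw [hh, eval_pow, eval_sub, eval_X, eval_C, norm_pow, e, norm_mul, Complex.norm_I, mul_one,
      Complex.norm_real, Real.norm_eq_abs, habs]
  have h1 := hone (ξ + t * Complex.I) (by simp) (by simp) hAle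
  have h2 := hone (ξ - t * Complex.I) (by simp) (by simp) (by
    have e1 : (1 : ℂ) - (ξ - t * Complex.I) ^ 2 =
        (starRingEnd ℂ) (1 - (ξ + t * Complex.I) ^ 2) := by simp [sub_eq_add_neg]
    have e2 : (x : ℂ) - (ξ - t * Complex.I) =
        (starRingEnd ℂ) (x - (ξ + t * Complex.I)) := by simp [sub_eq_add_neg]
    rwa [e1, e2, Complex.norm_conj, Complex.norm_conj])
  have hfun : (fun y : ℝ => (((y - ξ) ^ j / ((y - ξ) ^ 2 + t ^ 2) : ℝ) : ℂ)) = fun y : ℝ =>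
      (2 * t * Complex.I)⁻¹ * (h.eval (y : ℂ) / (y - (ξ + t * Complex.I)) -
        h.eval (y : ℂ) / (y - (ξ - t * Complex.I))) := by
    funext y
    have ht' : (t : ℂ) ≠ 0 := by exact_mod_cast ht.ne'
    have hne1 : (y : ℂ) - (ξ + t * Complex.I) ≠ 0 := by
      intro h0
      have := congrArg Complex.im h0
      simp at this
      exact ht.ne' this
    have hne2 : (y : ℂ) - (ξ - t * Complex.I) ≠ 0 := by
      intro h0
      have := congrArg Complex.im h0
      simp at this
      exact ht.ne' this
    have hprod : ((y : ℂ) - ξ) ^ 2 + t ^ 2 =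
        (y - (ξ + t * Complex.I)) * (y - (ξ - t * Complex.I)) := by
      linear_combination ((t : ℂ) ^ 2) * Complex.I_sq
    push_cast
    rw [hprod]
    simp only [hh, eval_pow, eval_sub, eval_X, eval_C]
    field_simp
    ring
  have h3 := lobattoError_ofReal n (fun y : ℝ => (y - ξ) ^ j / ((y - ξ) ^ 2 + t ^ 2)) x
  rw [hfun, lobattoError_const_mul, lobattoError_sub] at h3
  rw [← Real.norm_eq_abs, ← Complex.norm_real, ← h3, norm_mul]
  have h4 : ‖(2 * t * Complex.I : ℂ)⁻¹‖ = (2 * t)⁻¹ := by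
    simp [abs_of_pos ht]
  rw [h4]
  calc (2 * t)⁻¹ * _ ≤ (2 * t)⁻¹ * (B + B) := by
        gcongr
        exact (norm_sub_le _ _).trans (add_le_add h1 h2)
    _ = _ := by rw [hB]; field_simp; ring

/-- There is a single pole `z = ε(1 + t)`. There `1 - εz = -t`, `√|1 - z²| ≥ √t` and `|x - z| ≥ 1 -
εx`; the factor `-ε` in `h` accounts for `y - z = -ε(1 - εy + t)`. -/
lemma abs_lobattoError_endpoint_kernel_le {n M j : ℕ} {c : ℝ} (hn : 1 ≤ n) (hc : 0 < c)
    (hlow : ∀ (θ : ℂ) (u : ℝ), 0 < u → u ≤ Real.sinh |θ.im| →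
      √‖1 - Complex.cos θ ^ 2‖ * (c * (n * u + (n * u) ^ M)) ≤
        ‖(lobattoNodal n).eval (Complex.cos θ)‖)
    (hj : j ≤ n + 1) {ε t x : ℝ} (hε : ε = 1 ∨ ε = -1) (ht : 0 < t) (hx : x ∈ Icc (-1 : ℝ) 1)
    (hxε : 0 < 1 - ε * x) :
    |lobattoError n (fun y : ℝ => (1 - ε * y) ^ j / (1 - ε * y + t)) x| ≤
      t ^ j * √(1 - x ^ 2) / (√t * (1 - ε * x) * c * (n * √t + (n * √t) ^ M)) := by
  have hε2 : ε * ε = 1 := by rcases hε with rfl | rfl <;> norm_num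
  have hεabs : |ε| = 1 := by rcases hε with rfl | rfl <;> norm_num
  set h : ℂ[X] := C (-ε : ℂ) * (1 - C (ε : ℂ) * X) ^ j with hh
  have hdeg : h.natDegree ≤ n + 1 := by
    refine (natDegree_C_mul_le _ _).trans (natDegree_pow_le.trans ?_)
    have : (1 - C (ε : ℂ) * X : ℂ[X]).natDegree ≤ 1 := by compute_degree
    nlinarith
  obtain ⟨θ, hθ⟩ := Complex.cos_surjective ((ε * (1 + t) : ℝ) : ℂ)
  have hre : |(Complex.cos θ).re| = 1 + t := by
    rw [hθ, Complex.ofReal_re, abs_mul, hεabs, one_mul, abs_of_pos (by linarith)]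
  have hsq : √t ≤ √‖1 - Complex.cos θ ^ 2‖ := by
    refine Real.sqrt_le_sqrt ?_
    rw [hθ, ← Complex.ofReal_pow, ← Complex.ofReal_one, ← Complex.ofReal_sub, Complex.norm_real,
      Real.norm_eq_abs, abs_sub_comm]
    refine le_trans ?_ (le_abs_self _)
    have : (ε * (1 + t)) ^ 2 = (1 + t) ^ 2 := by rw [mul_pow, pow_two ε, hε2, one_mul]
    nlinarith
  have hxz : 1 - ε * x ≤ ‖(x : ℂ) - Complex.cos θ‖ := by
    rw [hθ, ← Complex.ofReal_sub, Complex.norm_real, Real.norm_eq_abs]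
    have : |x - ε * (1 + t)| = |ε * (x - ε * (1 + t))| := by rw [abs_mul, hεabs, one_mul]
    rw [this, mul_sub, ← mul_assoc, hε2, one_mul, abs_sub_comm]
    exact le_trans (by linarith) (le_abs_self _)
  have hsqt : 0 < √t := Real.sqrt_pos.2 ht
  have key := norm_lobattoError_div_le hn hc hlow hdeg (θ := θ) hsqt
    (sqrt_le_sinh_abs_im_of_cos_re ht.le hre.ge) hx (A := √t * (1 - ε * x)) (by positivity)
    (by gcongr) (H := t ^ j) (le_of_eq (by
      rw [hh, hθ]
      simp only [eval_mul, eval_C, eval_pow, eval_sub, eval_one, eval_X]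
      have : (1 : ℂ) - ε * ((ε * (1 + t) : ℝ) : ℂ) = ((-t : ℝ) : ℂ) := by
        have : (1 : ℝ) - ε * (ε * (1 + t)) = -t := by rw [← mul_assoc, hε2]; ring
        rw [← this]
        push_cast
        ring
      rw [this, norm_mul, norm_neg, Complex.norm_real, Real.norm_eq_abs, hεabs, one_mul, norm_pow,
        Complex.norm_real, norm_neg, Real.norm_of_nonneg ht.le]))
  refine le_trans (le_of_eq ?_) key
  rw [← Real.norm_eq_abs, ← Complex.norm_real, ← lobattoError_ofReal]
  congr 1
  refine lobattoError_congr_of_eqOn hx fun y hy => ?_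
  have hpos : 0 < 1 - ε * y + t := by
    have : ε * y ≤ 1 := by
      rcases hε with rfl | rfl
      · linarith [hy.2]
      · linarith [hy.1]
    linarith
  have hne : ((1 - ε * y + t : ℝ) : ℂ) ≠ 0 := by exact_mod_cast hpos.ne'
  have hε2' : (ε : ℂ) * ε = 1 := by exact_mod_cast hε2
  have e : (y : ℂ) - Complex.cos θ = -ε * ((1 - ε * y + t : ℝ) : ℂ) := by
    rw [hθ]
    push_cast
    linear_combination (-(y : ℂ)) * hε2'
  have hεne : (-ε : ℂ) ≠ 0 := by
    intro h0
    rw [neg_eq_zero] at h0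
    rw [h0, zero_mul] at hε2'
    exact zero_ne_one hε2'
  rw [e, hh]
  simp only [eval_mul, eval_C, eval_pow, eval_sub, eval_one, eval_X]
  rw [mul_div_mul_left _ _ hεne]
  push_cast
  rfl

/-! ### The weighted pointwise error bound for powers. -/

/-- Interpolation error of a (possibly odd) power centred at `ξ`. The number `A t ^ b` bounds from
below the distance of the poles `ξ ± i t` to `x` and to `±1`. -/
lemma exists_abs_lobattoError_pow_mul_abs_rpow_le {s : ℝ} (hs0 : 0 < s) (hs2 : s < 2) (l b : ℕ)
    (hb : (b : ℝ) < s + l) : ∃ C : ℝ, ∃ n₀ : ℕ, 0 ≤ C ∧ ∀ n ≥ n₀, ∀ ξ : ℝ, ∀ x ∈ Icc (-1 : ℝ) 1,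
      ∀ A : ℝ, 0 < A → (∀ t : ℝ, 0 < t → A * t ^ b ≤
        √‖1 - ((ξ : ℂ) + t * Complex.I) ^ 2‖ * ‖(x : ℂ) - ((ξ : ℂ) + t * Complex.I)‖) →
      |lobattoError n (fun y => (y - ξ) ^ l * |y - ξ| ^ s) x| * A ≤
        C * (√(1 - x ^ 2) * (n : ℝ) ^ (-1 - (s + l - b))) := by
  set a : ℝ := s + l - b with ha
  have ha0 : 0 < a := by rw [ha]; linarith
  -- Large enough for `a - M < -1`, the integrability condition at infinity.
  set M : ℕ := ⌈a⌉₊ + 2 with hM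
  obtain ⟨c, hc⟩ := exists_rpow_eq_integral two_ne_zero hs0 (by exact_mod_cast hs2)
  obtain ⟨d, hd, hlow⟩ := le_norm_eval_lobattoNodal M (by omega)
  obtain ⟨J, hJ0, hJ⟩ := exists_abs_integral_le_of_scaling (a := a) (κ := 1) (M := M) (by linarith)
    (by
      have := Nat.le_ceil a
      rw [hM]
      push_cast
      linarith)
  refine ⟨|c| / d * J, 2 * M + l + 2, by positivity, fun n hn ξ x hx A hA hAt => ?_⟩
  have hn0 : (0 : ℝ) < n := by
    have : 0 < n := by omega
    exact_mod_cast this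
  -- The numerator has degree `l + 2`, the extra `2` coming from `w²` in the representation of
  -- `w^s`; it must not exceed `n + 1`.
  set K : ℝ → ℝ → ℝ := fun t y => c * t ^ (s - 1) * ((y - ξ) ^ (l + 2) / ((y - ξ) ^ 2 + t ^ 2))
    with hK
  have hrep : ∀ y, (y - ξ) ^ l * |y - ξ| ^ s = ∫ t in Ioi 0, K t y := by
    intro y
    rw [hc |y - ξ| (abs_nonneg _), sq_abs, mul_left_comm, ← integral_const_mul, ← integral_const_mul]
    congr 1
    funext t
    rw [hK]
    ring
  have hKint : ∀ y ∈ Icc (-1 : ℝ) 1, Integrable (fun t => K t y) (volume.restrict (Ioi 0)) := by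
    intro y _
    have h := integrableOn_rpow_mul_pow_div two_ne_zero hs0 (by exact_mod_cast hs2)
      (abs_nonneg (y - ξ))
    rw [sq_abs] at h
    refine (Integrable.const_mul h (c * (y - ξ) ^ l)).congr (ae_of_all _ fun t => ?_)
    simp only [hK]
    ring
  have hbound := hJ n (|c| * √(1 - x ^ 2) / (A * d)) (fun t => lobattoError n (K t) x) hn0 (by
    intro t ht
    have hk := abs_lobattoError_interior_kernel_le (by omega) hd (hlow n (by omega))
      (j := l + 2) (by omega) ht hx (A := A * t ^ b) (by positivity) (hAt t ht)
    simp only [hK]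
    rw [lobattoError_const_mul, abs_mul, abs_mul, abs_of_pos (Real.rpow_pos_of_pos ht _)]
    refine (mul_le_mul_of_nonneg_left hk (by positivity)).trans (le_of_eq ?_)
    rw [Real.rpow_one, ha, Real.rpow_sub_one ht.ne' s, Real.rpow_sub ht (s + l) b,
      Real.rpow_add ht s l, Real.rpow_natCast, Real.rpow_natCast]
    field_simp
    ring)
  have e : lobattoError n (fun y => (y - ξ) ^ l * |y - ξ| ^ s) x =
      ∫ t in Ioi 0, lobattoError n (K t) x := by
    rw [← lobattoError_integral n hx hKint]
    exact congrArg (fun F => lobattoError n F x) (funext hrep)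
  rw [e]
  refine (mul_le_mul_of_nonneg_right hbound hA.le).trans (le_of_eq ?_)
  field_simp

/-- The pointwise error estimate from which all rates of convergence are derived. -/
def HasLobattoErrorBound (F : ℝ → ℝ) (ξ e : ℝ) : Prop :=
  ∃ C : ℝ, ∃ n₀ : ℕ, 1 ≤ n₀ ∧ 0 ≤ C ∧ ∀ n ≥ n₀, ∀ x ∈ Icc (-1 : ℝ) 1,
    |lobattoError n F x| * |x - ξ| ≤ C * (√(1 - x ^ 2) * (n : ℝ) ^ (-1 - e))

namespace HasLobattoErrorBound
variable {F G : ℝ → ℝ} {ξ e : ℝ}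

lemma congr (hF : HasLobattoErrorBound F ξ e) (h : EqOn F G (Icc (-1) 1)) :
    HasLobattoErrorBound G ξ e := by
  obtain ⟨C, n₀, hn₀, hC, hb⟩ := hF
  exact ⟨C, n₀, hn₀, hC, fun n hn x hx => by
    rw [← lobattoError_congr_of_eqOn hx h]
    exact hb n hn x hx⟩

lemma mono (hF : HasLobattoErrorBound F ξ e) {e' : ℝ} (h : e' ≤ e) :
    HasLobattoErrorBound F ξ e' := by
  obtain ⟨C, n₀, hn₀, hC, hb⟩ := hF
  refine ⟨C, n₀, hn₀, hC, fun n hn x hx => (hb n hn x hx).trans ?_⟩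
  have : (1 : ℝ) ≤ n := by exact_mod_cast hn₀.trans hn
  gcongr

lemma add (hF : HasLobattoErrorBound F ξ e) (hG : HasLobattoErrorBound G ξ e) :
    HasLobattoErrorBound (fun y => F y + G y) ξ e := by
  obtain ⟨C, n₀, hn₀, hC, hb⟩ := hF
  obtain ⟨C', n₁, hn₁, hC', hb'⟩ := hG
  refine ⟨C + C', max n₀ n₁, hn₀.trans (le_max_left _ _), by positivity, fun n hn x hx => ?_⟩
  have h1 := hb n ((le_max_left _ _).trans hn) x hx
  have h2 := hb' n ((le_max_right _ _).trans hn) x hx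
  rw [lobattoError_add]
  have := mul_le_mul_of_nonneg_right (abs_add_le (lobattoError n F x) (lobattoError n G x))
    (abs_nonneg (x - ξ))
  linarith

lemma const_mul (hF : HasLobattoErrorBound F ξ e) (c : ℝ) :
    HasLobattoErrorBound (fun y => c * F y) ξ e := by
  obtain ⟨C, n₀, hn₀, hC, hb⟩ := hF
  refine ⟨|c| * C, n₀, hn₀, by positivity, fun n hn x hx => ?_⟩
  rw [lobattoError_const_mul, abs_mul, mul_assoc, mul_assoc]
  exact mul_le_mul_of_nonneg_left (hb n hn x hx) (abs_nonneg _)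

lemma zero : HasLobattoErrorBound (fun _ => 0) ξ e :=
  ⟨0, 1, le_rfl, le_rfl, fun n _ x _ => by simp [lobattoError]⟩

lemma sum {ι : Type*} {s : Finset ι} {F : ι → ℝ → ℝ}
    (h : ∀ i ∈ s, HasLobattoErrorBound (F i) ξ e) :
    HasLobattoErrorBound (fun y => ∑ i ∈ s, F i y) ξ e := by
  classical
  induction s using Finset.induction_on with
  | empty => simpa using zero
  | insert i s hi ih =>
    simp_rw [Finset.sum_insert hi]
    exact (h i (Finset.mem_insert_self _ _)).add
      (ih fun j hj => h j (Finset.mem_insert_of_mem hj))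

end HasLobattoErrorBound

/-- All three factors `x - z`, `1 - z`, `1 + z` have imaginary part `±t`. The bound is uniform in
`x` and `ξ`, at the price of two powers of `t`. -/
lemma sq_le_norm_mul {ξ x t : ℝ} (ht : 0 < t) :
    t ^ 2 ≤ √‖1 - ((ξ : ℂ) + t * Complex.I) ^ 2‖ * ‖(x : ℂ) - ((ξ : ℂ) + t * Complex.I)‖ := by
  have h : ∀ w : ℂ, |w.im| = t → t ≤ ‖w‖ := fun w hw => hw ▸ Complex.abs_im_le_norm w
  have h1 := h ((x : ℂ) - ((ξ : ℂ) + t * Complex.I)) (by simp [abs_of_pos ht])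
  have h2 := h (1 - ((ξ : ℂ) + t * Complex.I)) (by simp [abs_of_pos ht])
  have h3 := h (1 + ((ξ : ℂ) + t * Complex.I)) (by simp [abs_of_pos ht])
  have h4 : t ≤ √‖1 - ((ξ : ℂ) + t * Complex.I) ^ 2‖ := by
    refine Real.le_sqrt_of_sq_le ?_
    have : (1 : ℂ) - (ξ + t * Complex.I) ^ 2 =
      (1 - (ξ + t * Complex.I)) * (1 + (ξ + t * Complex.I)) := by ring
    rw [this, norm_mul, pow_two]
    gcongr
  rw [pow_two]
  gcongr

lemma sqrt_mul_abs_le_norm_mul {ξ x t : ℝ} :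
    √(1 - ξ ^ 2) * |x - ξ| ≤
      √‖1 - ((ξ : ℂ) + t * Complex.I) ^ 2‖ * ‖(x : ℂ) - ((ξ : ℂ) + t * Complex.I)‖ := by
  gcongr
  · have h := Complex.abs_re_le_norm (1 - ((ξ : ℂ) + t * Complex.I) ^ 2)
    have e : (1 - ((ξ : ℂ) + t * Complex.I) ^ 2).re = 1 - ξ ^ 2 + t ^ 2 := by
      simp [pow_two]
      ring
    rw [e] at h
    exact (le_trans (by nlinarith) (le_abs_self _)).trans h
  · have h := Complex.abs_re_le_norm ((x : ℂ) - ((ξ : ℂ) + t * Complex.I))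
    simpa using h

lemma abs_rpow_two_mul_add (k : ℕ) {s : ℝ} (hs : 0 ≤ s) (y : ℝ) :
    |y| ^ (2 * (k : ℝ) + s) = y ^ (2 * k) * |y| ^ s := by
  rw [Real.rpow_add_of_nonneg (abs_nonneg _) (by positivity) hs,
    show (2 * (k : ℝ)) = ((2 * k : ℕ) : ℝ) by push_cast; ring, Real.rpow_natCast, pow_mul, pow_mul,
    sq_abs]

/-- Removing the even integer `2⌊σ/2⌋` leaves `s` in `(0,2)`, the range of the representation with
`ρ = 2`; `s > 0` because `σ` is not even. The lower bound `√(1 - ξ²) |x - ξ|`, with no loss in `t`,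
supplies the weight. -/
lemma hasLobattoErrorBound_interior {ξ σ : ℝ} (hξ : ξ ∈ Ioo (-1 : ℝ) 1) (hσ : 0 < σ)
    (hσ2 : ∀ k : ℤ, σ ≠ 2 * (k : ℝ)) (i : ℕ) :
    HasLobattoErrorBound (fun y => (y - ξ) ^ i * |y - ξ| ^ σ) ξ σ := by
  set k : ℕ := ⌊σ / 2⌋₊ with hk
  set s : ℝ := σ - 2 * k with hs
  have hk1 : (k : ℝ) ≤ σ / 2 := Nat.floor_le (by positivity)
  have hk2 : σ / 2 < k + 1 := Nat.lt_floor_add_one _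
  have hs0 : 0 < s := by
    rcases (show 0 ≤ s by rw [hs]; linarith).eq_or_lt with h | h
    · exact absurd (by rw [hs] at h; push_cast; linarith) (hσ2 k)
    · exact h
  have hσs : σ = 2 * k + s := by rw [hs]; ring
  obtain ⟨C, n₀, hC, hb⟩ := exists_abs_lobattoError_pow_mul_abs_rpow_le hs0
    (by rw [hs]; linarith) (i + 2 * k) 0 (by push_cast; positivity)
  have hξ2 : 0 < 1 - ξ ^ 2 := by nlinarith [hξ.1, hξ.2]
  have hsq : 0 < √(1 - ξ ^ 2) := Real.sqrt_pos.2 hξ2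
  have hfun : ∀ y, (y - ξ) ^ i * |y - ξ| ^ σ = (y - ξ) ^ (i + 2 * k) * |y - ξ| ^ s := by
    intro y
    rw [hσs, abs_rpow_two_mul_add k hs0.le, pow_add, mul_assoc]
  refine ⟨C / √(1 - ξ ^ 2), max n₀ 1, le_max_right _ _, by positivity, fun n hn x hx => ?_⟩
  have hn1 : (1 : ℝ) ≤ n := by exact_mod_cast (le_max_right _ _).trans hn
  rcases eq_or_ne x ξ with rfl | hne
  · rw [sub_self, abs_zero, mul_zero]
    positivity
  have hxξ : 0 < |x - ξ| := abs_pos.2 (sub_ne_zero.2 hne)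
  have h := hb n ((le_max_left _ _).trans hn) ξ x hx (√(1 - ξ ^ 2) * |x - ξ|) (by positivity)
    (fun t _ => by simpa using sqrt_mul_abs_le_norm_mul)
  simp_rw [hfun]
  rw [div_mul_eq_mul_div, le_div_iff₀ hsq]
  calc _ = |lobattoError n (fun y => (y - ξ) ^ (i + 2 * k) * |y - ξ| ^ s) x| *
        (√(1 - ξ ^ 2) * |x - ξ|) := by ring
    _ ≤ _ := h
    _ ≤ _ := by
      gcongr
      rw [hσs]
      push_cast
      have : (0 : ℝ) ≤ i := by positivity
      linarith

/-- On `[-1,1]` the base `1 - εy` is nonnegative, so only the integer `⌊σ⌋` is removed and the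
representation with `ρ = 1` applies, with `s > 0` because `σ` is not an integer. -/
lemma hasLobattoErrorBound_endpoint {ε σ : ℝ} (hε : ε = 1 ∨ ε = -1) (hσ : 0 < σ)
    (hσ1 : ∀ k : ℤ, σ ≠ k) (i : ℕ) :
    HasLobattoErrorBound (fun y => (1 - ε * y) ^ i * (1 - ε * y) ^ σ) ε (2 * σ) := by
  set k : ℕ := ⌊σ⌋₊ with hk
  set s : ℝ := σ - k with hs
  have hk1 : (k : ℝ) ≤ σ := Nat.floor_le hσ.le
  have hk2 : σ < k + 1 := Nat.lt_floor_add_one _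
  have hs0 : 0 < s := by
    rcases (show 0 ≤ s by rw [hs]; linarith).eq_or_lt with h | h
    · exact absurd (by rw [hs] at h; push_cast; linarith) (hσ1 k)
    · exact h
  have hσs : σ = k + s := by rw [hs]; ring
  set l : ℕ := i + k with hl
  -- The exponent of `t^(s-1) t^(l+1) / √t`. As `(n²)^(-1-a) = n^(-1-2(s+l))`, this yields the rate
  -- `2σ`.
  set a : ℝ := s + l - 1 / 2 with ha
  set M : ℕ := 2 * ⌈s + l⌉₊ + 4 with hM
  have hs1 : s < (1 : ℕ) := by rw [hs]; push_cast; linarith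
  have hl0 : (0 : ℝ) ≤ l := by positivity
  obtain ⟨c, hc⟩ := exists_rpow_eq_integral one_ne_zero hs0 hs1
  obtain ⟨d, hd, hlow⟩ := le_norm_eval_lobattoNodal M (by omega)
  obtain ⟨J, hJ0, hJ⟩ := exists_abs_integral_le_of_scaling (a := a) (κ := 1 / 2) (M := M)
    (by rw [ha]; linarith)
    (by
      have := Nat.le_ceil (s + l)
      rw [hM, ha]
      push_cast
      linarith)
  refine ⟨|c| / d * J, 2 * M + l + 2, by omega, by positivity, fun n hn x hx => ?_⟩
  have hn1 : (1 : ℝ) ≤ n := by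
    have : 1 ≤ n := by omega
    exact_mod_cast this
  have hn0 : (0 : ℝ) < n := by linarith
  have hε2 : ε * ε = 1 := by rcases hε with rfl | rfl <;> norm_num
  have hεabs : |ε| = 1 := by rcases hε with rfl | rfl <;> norm_num
  have hw0 : ∀ y ∈ Icc (-1 : ℝ) 1, 0 ≤ 1 - ε * y := by
    intro y hy
    rcases hε with rfl | rfl
    · linarith [hy.2]
    · linarith [hy.1]
  have hxw : |x - ε| = 1 - ε * x := by
    have : |x - ε| = |ε * (x - ε)| := by rw [abs_mul, hεabs, one_mul]
    rw [this, mul_sub, hε2, abs_sub_comm, abs_of_nonneg (hw0 x hx)]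
  rcases (hw0 x hx).eq_or_lt with h0 | hxpos
  · rw [hxw, ← h0, mul_zero]
    positivity
  set K : ℝ → ℝ → ℝ := fun t y => c * t ^ (s - 1) * ((1 - ε * y) ^ (l + 1) / (1 - ε * y + t))
    with hK
  have hrep : EqOn (fun y => (1 - ε * y) ^ i * (1 - ε * y) ^ σ)
      (fun y => ∫ t in Ioi 0, K t y) (Icc (-1) 1) := by
    intro y hy
    simp only
    rw [hσs, Real.rpow_add_of_nonneg (hw0 y hy) (by positivity) hs0.le, Real.rpow_natCast,
      ← mul_assoc, ← pow_add, ← hl, hc _ (hw0 y hy), mul_left_comm, ← integral_const_mul,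
      ← integral_const_mul]
    congr 1
    funext t
    rw [hK]
    simp only [pow_one]
    ring
  have hKint : ∀ y ∈ Icc (-1 : ℝ) 1, Integrable (fun t => K t y) (volume.restrict (Ioi 0)) := by
    intro y hy
    have h := integrableOn_rpow_mul_pow_div one_ne_zero hs0 hs1 (hw0 y hy)
    refine (Integrable.const_mul h (c * (1 - ε * y) ^ l)).congr (ae_of_all _ fun t => ?_)
    simp only [hK, pow_one]
    ring
  have hbound := hJ (n ^ 2) (|c| * √(1 - x ^ 2) / ((1 - ε * x) * d))
    (fun t => lobattoError n (K t) x) (by positivity) (by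
    intro t ht
    have hk := abs_lobattoError_endpoint_kernel_le (by omega) hd (hlow n (by omega))
      (j := l + 1) (by omega) hε ht hx hxpos
    simp only [hK]
    rw [lobattoError_const_mul, abs_mul, abs_mul, abs_of_pos (Real.rpow_pos_of_pos ht _)]
    refine (mul_le_mul_of_nonneg_left hk (by positivity)).trans (le_of_eq ?_)
    rw [← Real.sqrt_eq_rpow, Real.sqrt_mul (by positivity), Real.sqrt_sq hn0.le, ha,
      Real.rpow_sub_one ht.ne' s, Real.rpow_sub ht (s + l) (1 / 2), ← Real.sqrt_eq_rpow,
      Real.rpow_add ht s l, Real.rpow_natCast]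
    have : 0 < √t := Real.sqrt_pos.2 ht
    field_simp
    ring)
  rw [lobattoError_congr_of_eqOn hx hrep, lobattoError_integral n hx hKint, hxw]
  refine (mul_le_mul_of_nonneg_right hbound hxpos.le).trans ?_
  have hexp : ((n : ℝ) ^ 2) ^ (-1 - a) ≤ (n : ℝ) ^ (-1 - 2 * σ) := by
    rw [← Real.rpow_natCast, ← Real.rpow_mul hn0.le]
    refine Real.rpow_le_rpow_of_exponent_le hn1 ?_
    rw [ha, hσs, hl]
    push_cast
    have : (0 : ℝ) ≤ i := by positivity
    linarith
  calc _ = |c| / d * J * (√(1 - x ^ 2) * ((n : ℝ) ^ 2) ^ (-1 - a)) := by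
        generalize 1 - ε * x = w at hxpos ⊢
        field_simp
    _ ≤ _ := by gcongr

/-! ### Smooth functions, and reduction of the model function to powers. -/

lemma continuousAt_iteratedDeriv_of_contDiffAt {R : ℝ → ℝ} {r : ℕ} {x : ℝ}
    (h : ContDiffAt ℝ r R x) : ContinuousAt (iteratedDeriv r R) x := by
  rw [iteratedDeriv_eq_equiv_comp]
  exact (LinearIsometryEquiv.continuous _).continuousAt.comp
    (h.continuousAt_iteratedFDeriv le_rfl)

/-- In Taylor's formula with integral remainder, the truncated power `(x - t)₊^r` is half of `(x -
t)^r + |x - t|^r` because `r` is odd. The domain of integration then no longer depends on `x`. -/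
lemma exists_eq_add_integral_of_contDiffAt {R : ℝ → ℝ} {r : ℕ} (hr : Odd r)
    (hR : ∀ x ∈ Icc (-1 : ℝ) 1, ContDiffAt ℝ (r + 1 : ℕ) R x) :
    ∃ T : ℝ[X], T.natDegree ≤ r ∧ ∀ x ∈ Icc (-1 : ℝ) 1, R x = T.eval x +
      ∫ t in Ioc (-1 : ℝ) 1, iteratedDeriv (r + 1) R t / (2 * r.factorial) *
        ((x - t) ^ r + |x - t| ^ r) := by
  set h := iteratedDeriv (r + 1) R with hh
  have hcont : ContinuousOn h (Icc (-1) 1) := fun x hx =>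
    (continuousAt_iteratedDeriv_of_contDiffAt (hR x hx)).continuousWithinAt
  refine ⟨∑ k ∈ Finset.range (r + 1), C ((k.factorial : ℝ)⁻¹ * iteratedDeriv k R (-1)) *
    (X + C 1) ^ k, ?_, fun x hx => ?_⟩
  · refine natDegree_sum_le_of_forall_le _ _ fun k hk => (natDegree_C_mul_le _ _).trans ?_
    rw [natDegree_pow, natDegree_X_add_C, mul_one]
    exact Nat.lt_succ_iff.1 (Finset.mem_range.1 hk)
  rcases hx.1.eq_or_lt with rfl | hx1
  · have hT : eval (-1) (∑ k ∈ Finset.range (r + 1),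
        C ((k.factorial : ℝ)⁻¹ * iteratedDeriv k R (-1)) * (X + C 1) ^ k) = R (-1) := by
      rw [eval_finsetSum, Finset.sum_eq_single_of_mem 0 (by simp)]
      · simp
      · intro k _ hk
        simp [hk]
    rw [hT, setIntegral_eq_zero_of_forall_eq_zero, add_zero]
    intro t ht
    have : |(-1) - t| = -((-1) - t) := abs_of_nonpos (by linarith [ht.1])
    rw [this, hr.neg_pow]
    ring
  have hu : uIcc (-1) x = Icc (-1) x := uIcc_of_le hx.1
  have hsub : Icc (-1) x ⊆ Icc (-1 : ℝ) 1 := Icc_subset_Icc_right hx.2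
  have hud : UniqueDiffOn ℝ (Icc (-1) x) := uniqueDiffOn_Icc hx1
  have htay := taylor_integral_remainder (f := R) (x := x) (x₀ := -1) (n := r)
    (fun y hy => (hR y (hsub (hu ▸ hy))).contDiffWithinAt)
  have hpoly : taylorWithinEval R r (uIcc (-1) x) (-1) x = eval x (∑ k ∈ Finset.range (r + 1),
        C ((k.factorial : ℝ)⁻¹ * iteratedDeriv k R (-1)) * (X + C 1) ^ k) := by
    rw [taylor_within_apply, eval_finsetSum]
    refine Finset.sum_congr rfl fun k hk => ?_
    rw [hu, iteratedDerivWithin_eq_iteratedDeriv hud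
      ((hR (-1) ⟨le_rfl, by norm_num⟩).of_le (by
        have := Finset.mem_range.1 hk
        exact_mod_cast this.le)) ⟨le_rfl, hx.1⟩]
    simp
    ring
  rw [← hpoly, ← sub_eq_iff_eq_add', htay, hu]
  set k : ℝ → ℝ := fun t => h t / (2 * r.factorial) * ((x - t) ^ r + |x - t| ^ r) with hk
  have hkc : ContinuousOn k (Icc (-1) 1) := by
    rw [hk]
    fun_prop
  have hki : ∀ a b : ℝ, a ∈ Icc (-1 : ℝ) 1 → b ∈ Icc (-1 : ℝ) 1 → IntervalIntegrable k volume a b :=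
    fun a b ha hb => (hkc.mono (uIcc_subset_Icc ha hb)).intervalIntegrable
  rw [← intervalIntegral.integral_of_le (by norm_num),
    ← intervalIntegral.integral_add_adjacent_intervals (b := x)
      (hki _ _ ⟨le_rfl, by norm_num⟩ hx) (hki _ _ hx ⟨by norm_num, le_rfl⟩)]
  have h2 : ∫ t in x..1, k t = 0 := by
    rw [intervalIntegral.integral_of_le hx.2]
    refine setIntegral_eq_zero_of_forall_eq_zero fun t ht => ?_
    have : |x - t| = -(x - t) := abs_of_nonpos (by linarith [ht.1])
    rw [hk]
    simp only
    rw [this, hr.neg_pow]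
    ring
  rw [h2, add_zero]
  refine intervalIntegral.integral_congr fun t ht => ?_
  rw [hu] at ht
  rw [iteratedDerivWithin_eq_iteratedDeriv hud (hR t (hsub ht)) ht, hk]
  have : |x - t| = x - t := abs_of_nonneg (by linarith [ht.2])
  simp only [smul_eq_mul]
  rw [this, ← hh]
  field_simp
  ring

/-- Smooth functions satisfy the pointwise error bound with a rate growing with the smoothness. -/
lemma hasLobattoErrorBound_of_contDiffAt {R : ℝ → ℝ} {k : ℕ} (hk : 1 ≤ k)
    (hR : ∀ x ∈ Icc (-1 : ℝ) 1, ContDiffAt ℝ (2 * k + 1 + 1 : ℕ) R x) {ξ : ℝ}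
    (hξ : ξ ∈ Icc (-1 : ℝ) 1) : HasLobattoErrorBound R ξ (2 * k - 1) := by
  obtain ⟨T, hT, hTR⟩ := exists_eq_add_integral_of_contDiffAt (odd_two_mul_add_one k) hR
  set r := 2 * k + 1 with hr
  set h := iteratedDeriv (r + 1) R with hh
  have hcont : ContinuousOn h (Icc (-1) 1) := fun x hx =>
    (continuousAt_iteratedDeriv_of_contDiffAt (hR x hx)).continuousWithinAt
  obtain ⟨H, hH⟩ := isCompact_Icc.exists_bound_of_continuousOn hcont
  have hH0 : 0 ≤ H := (norm_nonneg _).trans (hH 1 ⟨by norm_num, le_rfl⟩)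
  -- Here `|y - t|^r = (y - t)^(2k) |y - t|`. The centre `t` ranges over the whole interval, so the
  -- uniform bound with `b = 2`, `A = 1` is used, giving the rate `1 + 2k - 2`.
  obtain ⟨C, n₀, hC, hb⟩ := exists_abs_lobattoError_pow_mul_abs_rpow_le one_pos one_lt_two (2 * k) 2
    (by
      have : (1 : ℝ) ≤ k := by exact_mod_cast hk
      push_cast
      linarith)
  refine ⟨2 * H * C, n₀ + r + 1, by omega, by positivity, fun n hn x hx => ?_⟩
  set K : ℝ → ℝ → ℝ := fun t y => h t / (2 * r.factorial) * ((y - t) ^ r + |y - t| ^ r) with hK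
  have hKint : ∀ y ∈ Icc (-1 : ℝ) 1, Integrable (fun t => K t y) (volume.restrict (Ioc (-1) 1)) := by
    intro y _
    have : ContinuousOn (fun t => K t y) (Icc (-1) 1) := by
      simp only [hK]
      fun_prop
    exact (this.integrableOn_compact isCompact_Icc).mono_set Ioc_subset_Icc_self
  set S : ℝ := √(1 - x ^ 2) * (n : ℝ) ^ (-1 - (2 * (k : ℝ) - 1)) with hS
  have hS0 : 0 ≤ S := by positivity
  have hpt : ∀ t ∈ Ioc (-1 : ℝ) 1, ‖lobattoError n (K t) x‖ ≤ H / 2 * (C * S) := by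
    intro t ht
    have e1 : lobattoError n (fun y => (y - t) ^ r) x = 0 := by
      have := lobattoError_eval_eq_zero (n := n) (P := (X - Polynomial.C t) ^ r)
        (by rw [natDegree_pow, natDegree_X_sub_C]; omega) x
      simpa using this
    have e2 := hb n (by omega) t x hx 1 one_pos (fun u hu => by
      rw [one_mul]; exact sq_le_norm_mul hu)
    have e3 : (fun y : ℝ => (y - t) ^ (2 * k) * |y - t| ^ (1 : ℝ)) = fun y => |y - t| ^ r := by
      funext y
      rw [Real.rpow_one, hr, pow_succ, pow_mul, pow_mul, sq_abs]
    have e4 : (-1 - (1 + ((2 * k : ℕ) : ℝ) - (2 : ℕ)) : ℝ) = -1 - (2 * (k : ℝ) - 1) := by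
      push_cast
      ring
    rw [e3, mul_one, e4, ← hS] at e2
    simp only [hK]
    rw [lobattoError_const_mul, lobattoError_add, e1, zero_add, norm_mul, norm_div]
    have hfac : (2 : ℝ) ≤ ‖(2 * r.factorial : ℝ)‖ := by
      have : (1 : ℝ) ≤ r.factorial := by exact_mod_cast Nat.factorial_pos r
      rw [Real.norm_of_nonneg (by positivity)]
      linarith
    have := hH t (Ioc_subset_Icc_self ht)
    gcongr
    exact e2
  have hint := norm_setIntegral_le_of_norm_le_const (μ := volume) (by simp) hpt
  rw [Real.norm_eq_abs] at hint
  have hvol : (volume : Measure ℝ).real (Ioc (-1) 1) = 2 := by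
    rw [Real.volume_real_Ioc_of_le (by norm_num)]
    norm_num
  rw [hvol] at hint
  have herr : lobattoError n R x = ∫ t in Ioc (-1 : ℝ) 1, lobattoError n (K t) x := by
    rw [lobattoError_congr_of_eqOn hx (G := fun y => T.eval y + ∫ t in Ioc (-1 : ℝ) 1, K t y) hTR,
      lobattoError_add, lobattoError_eval_eq_zero (hT.trans (by omega)), zero_add,
      lobattoError_integral n hx hKint]
  rw [herr]
  have hxξ : |x - ξ| ≤ 2 := abs_le.2 ⟨by linarith [hx.1, hξ.2], by linarith [hx.2, hξ.1]⟩
  calc _ ≤ (H / 2 * (C * S) * 2) * 2 := by gcongr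
    _ = _ := by ring

lemma continuous_abs_rpow_sub_one_mul {σ : ℝ} (hσ : 0 < σ) :
    Continuous fun y : ℝ => |y| ^ (σ - 1) * y := by
  rw [continuous_iff_continuousAt]
  intro y
  rcases eq_or_ne y 0 with rfl | hy
  · have h : Tendsto (fun y : ℝ => |y| ^ σ) (nhds 0) (nhds 0) := by
      have : ContinuousAt (fun y : ℝ => |y| ^ σ) 0 :=
        continuousAt_id.abs.rpow_const (Or.inr hσ.le)
      simpa [ContinuousAt, hσ.ne'] using this
    rw [ContinuousAt, mul_zero]
    refine squeeze_zero_norm (fun z => ?_) h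
    rw [norm_mul, Real.norm_of_nonneg (by positivity), Real.norm_eq_abs]
    rcases eq_or_ne z 0 with rfl | hz
    · simp [hσ.ne']
    · rw [Real.rpow_sub_one (abs_pos.2 hz).ne', div_mul_cancel₀ _ (abs_pos.2 hz).ne']
  · exact (continuousAt_id.abs.rpow_const (Or.inl (abs_ne_zero.2 hy))).mul continuousAt_id

lemma hasDerivAt_abs_rpow_sub_one_mul {σ : ℝ} (hσ : 1 < σ) (y : ℝ) :
    HasDerivAt (fun y : ℝ => |y| ^ (σ - 1) * y) (σ * |y| ^ (σ - 1)) y := by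
  have hne : ∀ y : ℝ, y ≠ 0 →
      HasDerivAt (fun y : ℝ => |y| ^ (σ - 1) * y) (σ * |y| ^ (σ - 1)) y := by
    intro y hy
    have h1 : HasDerivAt (fun y : ℝ => |y| ^ (σ - 1)) (SignType.sign y * (σ - 1) * |y| ^ (σ - 1 - 1)) y :=
      (hasDerivAt_abs hy).rpow_const (Or.inl (abs_ne_zero.2 hy))
    refine (h1.mul (hasDerivAt_id y)).congr_deriv ?_
    rw [Real.rpow_sub_one (abs_ne_zero.2 hy) (σ - 1)]
    have h3 : (SignType.sign y : ℝ) * y = |y| := sign_mul_self y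
    have h4 : |y| ≠ 0 := abs_ne_zero.2 hy
    simp only [id, mul_one]
    field_simp
    linear_combination (σ - 1) * h3
  -- The derivative at `0` is obtained by continuous extension of the formula valid elsewhere.
  refine hasDerivAt_of_hasDerivAt_of_ne' (x := 0) (g := fun y => σ * |y| ^ (σ - 1)) hne
    (continuous_abs_rpow_sub_one_mul (by linarith)).continuousAt ?_ y
  exact continuousAt_const.mul (continuousAt_id.abs.rpow_const (Or.inr (by linarith)))

/-- Up to constants, differentiation exchanges the even and odd families while lowering `σ` by one,
so both are treated in one induction. -/
lemma contDiff_abs_rpow_and (m : ℕ) : ∀ σ : ℝ, (m : ℝ) < σ →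
    ContDiff ℝ m (fun y : ℝ => |y| ^ σ) ∧ ContDiff ℝ m (fun y : ℝ => |y| ^ (σ - 1) * y) := by
  induction m with
  | zero =>
    intro σ hσ
    rw [Nat.cast_zero] at hσ
    simp only [Nat.cast_zero, contDiff_zero]
    exact ⟨continuous_abs.rpow_const fun _ => Or.inr hσ.le, continuous_abs_rpow_sub_one_mul hσ⟩
  | succ m ih =>
    intro σ hσ
    push_cast at hσ
    have hm : (0 : ℝ) ≤ m := by positivity
    obtain ⟨h1, h2⟩ := ih (σ - 1) (by linarith)
    have hσ1 : 1 < σ := by linarith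
    push_cast
    rw [contDiff_succ_iff_deriv, contDiff_succ_iff_deriv]
    have d1 : deriv (fun y : ℝ => |y| ^ σ) = fun y => σ * (|y| ^ (σ - 1 - 1) * y) := by
      funext y
      rw [(hasDerivAt_abs_rpow y hσ1).deriv, sub_sub, mul_assoc]
      norm_num
    have d2 : deriv (fun y : ℝ => |y| ^ (σ - 1) * y) = fun y => σ * |y| ^ (σ - 1) :=
      funext fun y => (hasDerivAt_abs_rpow_sub_one_mul hσ1 y).deriv
    rw [d1, d2]
    exact ⟨⟨fun y => (hasDerivAt_abs_rpow y hσ1).differentiableAt, by simp, contDiff_const.mul h2⟩,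
      ⟨fun y => (hasDerivAt_abs_rpow_sub_one_mul hσ1 y).differentiableAt, by simp,
        contDiff_const.mul h1⟩⟩

lemma contDiff_abs_rpow {m : ℕ} {σ : ℝ} (h : (m : ℝ) < σ) : ContDiff ℝ m (fun y : ℝ => |y| ^ σ) :=
  (contDiff_abs_rpow_and m σ h).1

lemma contDiffOn_modelFun {g : ℝ → ℝ} (hg : AnalyticOnNhd ℝ g (Icc (-1) 1)) (ξ : ℝ) {σ : ℝ} {m : ℕ}
    (h : (m : ℝ) < σ) : ContDiffOn ℝ m (modelFun ξ σ g) (Icc (-1) 1) :=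
  (((contDiff_abs_rpow h).comp (contDiff_id.sub contDiff_const)).contDiffOn).mul
    fun x hx => (hg x hx).contDiffAt.contDiffWithinAt

lemma analyticOnNhd_dslope {g : ℝ → ℝ} {s : Set ℝ} (hg : AnalyticOnNhd ℝ g s) {ξ : ℝ}
    (hξ : ξ ∈ s) : AnalyticOnNhd ℝ (dslope g ξ) s := by
  intro x hx
  rcases eq_or_ne x ξ with rfl | hne
  · obtain ⟨p, hp⟩ := hg x hx
    exact hp.has_fpower_series_dslope_fslope.analyticAt
  · have h : AnalyticAt ℝ (fun y => (y - ξ)⁻¹ * (g y - g ξ)) x :=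
      ((analyticAt_id.sub analyticAt_const).inv (sub_ne_zero.2 hne)).mul
        ((hg x hx).sub analyticAt_const)
    refine h.congr ?_
    filter_upwards [dslope_eventuallyEq_slope_of_ne g hne] with y hy
    rw [hy, slope_def_field, div_eq_inv_mul]

/-- Finite Taylor expansion with analytic remainder. -/
lemma exists_eq_eval_add_pow_mul {s : Set ℝ} {ξ : ℝ} (hξ : ξ ∈ s) (N : ℕ) : ∀ g : ℝ → ℝ,
    AnalyticOnNhd ℝ g s → ∃ (P : ℝ[X]) (G : ℝ → ℝ), AnalyticOnNhd ℝ G s ∧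
      ∀ y, g y = P.eval (y - ξ) + (y - ξ) ^ N * G y := by
  induction N with
  | zero => exact fun g hg => ⟨0, g, hg, by simp⟩
  | succ N ih =>
    intro g hg
    obtain ⟨P, G, hG, h⟩ := ih _ (analyticOnNhd_dslope hg hξ)
    refine ⟨C (g ξ) + X * P, G, hG, fun y => ?_⟩
    have h1 := sub_smul_dslope g ξ y
    rw [h y, smul_eq_mul] at h1
    simp only [eval_add, eval_C, eval_mul, eval_X]
    linear_combination -h1

/-- Expand `g` at `ξ` to order `2(k + 1)`. The polynomial part gives the powers assumed under
control; the remainder carries `|y - ξ|^(2(k+1)+σ)`, hence has `2k + 2` continuous derivatives and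
rate `2k - 1 ≥ e`. -/
lemma hasLobattoErrorBound_modelFun {g : ℝ → ℝ} (hg : AnalyticOnNhd ℝ g (Icc (-1) 1)) {ξ σ e : ℝ}
    (hξ : ξ ∈ Icc (-1 : ℝ) 1) (hσ : 0 < σ)
    (h : ∀ i : ℕ, HasLobattoErrorBound (fun y => (y - ξ) ^ i * |y - ξ| ^ σ) ξ e) :
    HasLobattoErrorBound (modelFun ξ σ g) ξ e := by
  set k : ℕ := ⌈e⌉₊ + 1 with hk
  obtain ⟨P, G, hG, hPG⟩ := exists_eq_eval_add_pow_mul hξ (2 * (k + 1)) g hg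
  have hmain : HasLobattoErrorBound (fun y => ∑ i ∈ Finset.range (P.natDegree + 1),
      P.coeff i * ((y - ξ) ^ i * |y - ξ| ^ σ)) ξ e :=
    HasLobattoErrorBound.sum fun i _ => (h i).const_mul _
  have hrem : HasLobattoErrorBound (fun y => |y - ξ| ^ (2 * ((k + 1 : ℕ) : ℝ) + σ) * G y) ξ e := by
    refine (hasLobattoErrorBound_of_contDiffAt (k := k) (by omega) (fun x hx => ?_) hξ).mono ?_
    · have hc : ContDiff ℝ (2 * k + 1 + 1 : ℕ)
          (fun y : ℝ => |y - ξ| ^ (2 * ((k + 1 : ℕ) : ℝ) + σ)) :=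
        (contDiff_abs_rpow (by push_cast; linarith)).comp (contDiff_id.sub contDiff_const)
      exact hc.contDiffAt.mul (hG x hx).contDiffAt
    · have := Nat.le_ceil e
      have h0 : (0 : ℝ) ≤ ⌈e⌉₊ := by positivity
      rw [hk]
      push_cast
      linarith
  refine (hmain.add hrem).congr fun y _ => ?_
  simp only [modelFun]
  rw [hPG y, eval_eq_sum_range, abs_rpow_two_mul_add _ hσ.le, mul_add (|y - ξ| ^ σ), Finset.mul_sum]
  congr 1
  · exact Finset.sum_congr rfl fun i _ => by ring
  · ring

lemma hasLobattoErrorBound_modelFun_interior {g : ℝ → ℝ} (hg : AnalyticOnNhd ℝ g (Icc (-1) 1))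
    {ξ σ : ℝ} (hξ : ξ ∈ Ioo (-1 : ℝ) 1) (hσ : 0 < σ) (hσ2 : ∀ k : ℤ, σ ≠ 2 * (k : ℝ)) :
    HasLobattoErrorBound (modelFun ξ σ g) ξ σ :=
  hasLobattoErrorBound_modelFun hg (Ioo_subset_Icc_self hξ) hσ
    (hasLobattoErrorBound_interior hξ hσ hσ2)

lemma hasLobattoErrorBound_modelFun_endpoint {g : ℝ → ℝ} (hg : AnalyticOnNhd ℝ g (Icc (-1) 1))
    {ξ σ : ℝ} (hξ : ξ = 1 ∨ ξ = -1) (hσ : 0 < σ) (hσ1 : ∀ k : ℤ, σ ≠ k) :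
    HasLobattoErrorBound (modelFun ξ σ g) ξ (2 * σ) := by
  refine hasLobattoErrorBound_modelFun hg (by rcases hξ with rfl | rfl <;> norm_num) hσ fun i => ?_
  refine ((hasLobattoErrorBound_endpoint hξ hσ hσ1 i).const_mul ((-ξ) ^ i)).congr fun y hy => ?_
  have h1 : |y - ξ| = 1 - ξ * y := by
    rcases hξ with rfl | rfl
    · rw [abs_of_nonpos (by linarith [hy.2])]; ring
    · rw [abs_of_nonneg (by linarith [hy.1])]; ring
  have h2 : y - ξ = -ξ * (1 - ξ * y) := by
    rcases hξ with rfl | rfl <;> ring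
  simp only
  rw [h1, ← mul_assoc, ← mul_pow, ← h2]

/-! ### Rates for derivatives of the dyadic differences. -/

lemma natDegree_chebInterp_le (f : ℝ → ℝ) (n : ℕ) : (chebInterp f n).natDegree ≤ n := by
  have h := Lagrange.degree_interpolate_le (r := fun j => f (Chebyshev.node n j))
    (Chebyshev.strictAntiOn_node n).injOn
  rw [Finset.card_range, Nat.add_sub_cancel] at h
  exact natDegree_le_iff_degree_le.2 h

lemma pow_mul_rpow_le {x a b : ℝ} {j : ℕ} (hx : 1 ≤ x) (h : j + a ≤ b) : x ^ j * x ^ a ≤ x ^ b := by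
  rw [← Real.rpow_natCast, ← Real.rpow_add (by linarith)]
  exact Real.rpow_le_rpow_of_exponent_le hx h

lemma natDegree_dyadic_sub_le (f : ℝ → ℝ) (n : ℕ) :
    (chebInterp f (2 * n) - chebInterp f n).natDegree ≤ 2 * n :=
  (natDegree_sub_le _ _).trans (max_le (natDegree_chebInterp_le f _)
    ((natDegree_chebInterp_le f n).trans (by omega)))

namespace HasLobattoErrorBound
variable {f : ℝ → ℝ} {ξ e : ℝ}

lemma exists_dyadic_le (h : HasLobattoErrorBound f ξ e) (he : 0 < e) : ∃ C : ℝ, ∃ n₀ : ℕ,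
    1 ≤ n₀ ∧ 0 < C ∧ ∀ n ≥ n₀, ∀ x ∈ Icc (-1 : ℝ) 1,
      |(chebInterp f (2 * n) - chebInterp f n).eval x| * |x - ξ| ≤
        C * (√(1 - x ^ 2) * (n : ℝ) ^ (-1 - e)) := by
  obtain ⟨C, n₀, hn₀, hC, hb⟩ := h
  -- The summand `1` keeps the constant positive, as the polynomial inequalities require.
  refine ⟨2 * C + 1, n₀, hn₀, by positivity, fun n hn x hx => ?_⟩
  have hn1 : (1 : ℝ) ≤ n := by exact_mod_cast hn₀.trans hn
  have h1 := hb n hn x hx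
  have h2 := hb (2 * n) (by omega) x hx
  rw [lobattoError_eq] at h1 h2
  have h3 : (((2 * n : ℕ) : ℝ)) ^ (-1 - e) ≤ (n : ℝ) ^ (-1 - e) := by
    refine Real.rpow_le_rpow_of_nonpos (by linarith) ?_ (by linarith)
    push_cast
    linarith
  have h4 : C * (√(1 - x ^ 2) * (((2 * n : ℕ) : ℝ)) ^ (-1 - e)) ≤
      C * (√(1 - x ^ 2) * (n : ℝ) ^ (-1 - e)) := by gcongr
  have h5 : |(chebInterp f (2 * n) - chebInterp f n).eval x| ≤
      |f x - (chebInterp f n).eval x| + |f x - (chebInterp f (2 * n)).eval x| := by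
    rw [eval_sub]
    calc _ = |(f x - (chebInterp f n).eval x) - (f x - (chebInterp f (2 * n)).eval x)| := by ring_nf
      _ ≤ _ := abs_sub _ _
  have h6 := mul_le_mul_of_nonneg_right h5 (abs_nonneg (x - ξ))
  have h7 : 0 ≤ √(1 - x ^ 2) * (n : ℝ) ^ (-1 - e) := by positivity
  linarith

lemma tendsto_eval (h : HasLobattoErrorBound f ξ e) (he : 0 < e) {x : ℝ}
    (hx : x ∈ Icc (-1 : ℝ) 1) (hxξ : x ≠ ξ) :
    Tendsto (fun n => (chebInterp f n).eval x) atTop (nhds (f x)) := by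
  obtain ⟨C, n₀, hn₀, hC, hb⟩ := h
  have hpos : 0 < |x - ξ| := abs_pos.2 (sub_ne_zero.2 hxξ)
  rw [tendsto_iff_dist_tendsto_zero]
  have hlim : Tendsto (fun n : ℕ => C * (√(1 - x ^ 2) * (n : ℝ) ^ (-1 - e)) / |x - ξ|)
      atTop (nhds 0) := by
    have h1 : Tendsto (fun n : ℕ => (n : ℝ) ^ (-(1 + e))) atTop (nhds 0) :=
      (tendsto_rpow_neg_atTop (by linarith)).comp tendsto_natCast_atTop_atTop
    have h2 : (-(1 + e)) = -1 - e := by ring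
    rw [h2] at h1
    simpa using ((h1.const_mul (√(1 - x ^ 2))).const_mul C).div_const |x - ξ|
  refine squeeze_zero' (Eventually.of_forall fun _ => dist_nonneg) ?_ hlim
  filter_upwards [eventually_ge_atTop n₀] with n hn
  rw [dist_comm, Real.dist_eq, le_div_iff₀ hpos, ← lobattoError_eq]
  exact hb n hn x hx

/-- Rates for the derivatives of the dyadic differences on a neighbourhood of `x` give the rate of
the differentiation error at `x`. -/
lemma chebDiffError_isBigO (h : HasLobattoErrorBound f ξ e) (he : 0 < e)
    (hf : ContinuousOn f (Icc (-1) 1)) {a b x e' : ℝ} {m n₀ : ℕ} (hab : a < b)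
    (hsub : Icc a b ⊆ Icc (-1) 1) (hx : x ∈ Icc a b)
    (hnhds : Icc a b =ᶠ[nhds x] Icc (-1) 1) (he' : e' < 0)
    (hn₀ : 1 ≤ n₀) (hd : ∀ j ≤ m, ∃ C : ℝ, ∀ n ≥ n₀, ∀ y ∈ Icc a b,
      |(derivative^[j] (chebInterp f (2 * n) - chebInterp f n)).eval y| ≤ C * (n : ℝ) ^ e') :
    (fun n : ℕ => chebDiffError f m n x) =O[atTop] fun n : ℕ => (n : ℝ) ^ e' := by
  have hd' : ∀ j, ∃ C : ℝ, j ≤ m → ∀ n ≥ n₀, ∀ y ∈ Icc a b,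
      |(derivative^[j] (chebInterp f (2 * n) - chebInterp f n)).eval y| ≤ C * (n : ℝ) ^ e' := by
    intro j
    by_cases hj : j ≤ m
    · obtain ⟨C, hC⟩ := hd j hj
      exact ⟨C, fun _ => hC⟩
    · exact ⟨0, fun h => absurd h hj⟩
  choose C hC using hd'
  obtain ⟨C', hC'⟩ := exists_abs_iteratedDerivWithin_sub_le hab (p := chebInterp f) (hf.mono hsub)
    (m := m) hn₀ (C := ∑ j ∈ Finset.range (m + 1), |C j|) he' (ξ := ξ)
    (fun y hy hyξ => h.tendsto_eval he (hsub hy) hyξ) (fun j hj n hn y hy => by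
      refine (hC j hj n hn y hy).trans ?_
      gcongr
      exact (le_abs_self _).trans (Finset.single_le_sum (f := fun j => |C j|)
        (fun i _ => abs_nonneg _) (Finset.mem_range.2 (by omega))))
  refine IsBigO.of_bound C' ?_
  filter_upwards [eventually_ge_atTop n₀] with n hn
  rw [Real.norm_eq_abs, Real.norm_of_nonneg (by positivity), chebDiffError,
    ← show iteratedDerivWithin m f (Icc a b) x = iteratedDerivWithin m f (Icc (-1) 1) x by
      rw [iteratedDerivWithin, iteratedDerivWithin, iteratedFDerivWithin_congr_set hnhds]]
  exact hC' n hn x hx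

end HasLobattoErrorBound

lemma Icc_eventuallyEq_Icc_of_mem_Ioo {a b x : ℝ} (hx : x ∈ Ioo a b) (ha : -1 ≤ a) (hb : b ≤ 1) :
    Icc a b =ᶠ[nhds x] Icc (-1 : ℝ) 1 := by
  filter_upwards [Icc_mem_nhds hx.1 hx.2] with y hy
  exact propext ⟨fun _ => ⟨ha.trans hy.1, hy.2.trans hb⟩, fun _ => hy⟩

/-- A one-sided neighbourhood of an endpoint on which derivatives of polynomials dominated by
`√(1 - x ^ 2)` are controlled. -/
lemma exists_edge_interval {x₀ ξ : ℝ} (hx₀ : x₀ = 1 ∨ x₀ = -1) (hξ : ξ ∈ Icc (-1 : ℝ) 1)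
    (hne : x₀ ≠ ξ) : ∃ a b K : ℝ, a < b ∧ 0 < K ∧ Icc a b ⊆ Icc (-1) 1 ∧ x₀ ∈ Icc a b ∧
      Icc a b =ᶠ[nhds x₀] Icc (-1 : ℝ) 1 ∧ ∀ (Q : ℝ[X]) (N : ℕ) (A : ℝ), Q.natDegree ≤ N → 1 ≤ N →
        0 < A → (∀ x ∈ Icc (-1 : ℝ) 1, |Q.eval x| * |x - ξ| ≤ A * √(1 - x ^ 2)) →
        ∀ x ∈ Icc a b, |Q.eval x| ≤ K * A ∧ |Q.derivative.eval x| ≤ K * N * A := by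
  set δ := |x₀ - ξ| / 2 with hδ
  have hδ0 : 0 < δ := by
    have := abs_pos.2 (sub_ne_zero.2 hne)
    positivity
  have hδ1 : δ ≤ 1 := by
    have : |x₀ - ξ| ≤ 2 := by
      rw [abs_le]
      rcases hx₀ with rfl | rfl <;> constructor <;> linarith [hξ.1, hξ.2]
    rw [hδ]
    linarith
  have hx₀2 : x₀ * x₀ = 1 := by rcases hx₀ with rfl | rfl <;> norm_num
  have hx₀a : |x₀| = 1 := by rcases hx₀ with rfl | rfl <;> norm_num
  have hs2 : 0 < √2 := by positivity
  have hsδ : 0 < √δ := Real.sqrt_pos.2 hδ0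
  set K : ℝ := max (√2 / δ) (48 / √δ * (√2 / δ)) with hK
  -- The map `x ↦ x₀ x` moves either endpoint to `1`. Within `δ` of it `|x - ξ| ≥ δ`, and `1 - x² ≤
  -- 2(1 - x)`.
  have hcore : ∀ (Q : ℝ[X]) (N : ℕ) (A : ℝ), Q.natDegree ≤ N → 1 ≤ N →
        0 < A → (∀ x ∈ Icc (-1 : ℝ) 1, |Q.eval x| * |x - ξ| ≤ A * √(1 - x ^ 2)) →
        ∀ x ∈ Icc (1 - δ / 4) 1, |Q.eval (x₀ * x)| ≤ K * A ∧
          |Q.derivative.eval (x₀ * x)| ≤ K * N * A := by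
    intro Q N A hN hN1 hA hQ
    have hN0 : (0 : ℝ) < N := by exact_mod_cast hN1
    set R := Q.comp (C x₀ * X) with hR
    have hRe : ∀ y, R.eval y = Q.eval (x₀ * y) := by intro y; simp [hR]
    have hRd : R.natDegree ≤ N := by
      refine natDegree_comp_le.trans ?_
      calc Q.natDegree * _ ≤ N * 1 := Nat.mul_le_mul hN ((natDegree_C_mul_le _ _).trans natDegree_X_le)
        _ = N := mul_one _
    have hRb : ∀ x ∈ Icc (1 - δ) 1, |R.eval x| ≤ √2 / δ * A * √(1 - x) := by
      intro x hx
      have hx0 : 0 ≤ x := by linarith [hx.1]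
      have hmem : x₀ * x ∈ Icc (-1 : ℝ) 1 := by
        rw [mem_Icc, ← abs_le, abs_mul, hx₀a, one_mul, abs_of_nonneg hx0]
        exact hx.2
      have h1 := hQ _ hmem
      have h2 : δ ≤ |x₀ * x - ξ| := by
        have h3 : |x₀ - ξ| ≤ |x₀ - x₀ * x| + |x₀ * x - ξ| := abs_sub_le _ _ _
        have h4 : |x₀ - x₀ * x| ≤ δ := by
          rw [show x₀ - x₀ * x = x₀ * (1 - x) by ring, abs_mul, hx₀a, one_mul,
            abs_of_nonneg (by linarith [hx.2])]
          linarith [hx.1]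
        have h5 : |x₀ - ξ| = 2 * δ := by rw [hδ]; ring
        linarith
      have h3 : √(1 - (x₀ * x) ^ 2) ≤ √2 * √(1 - x) := by
        rw [← Real.sqrt_mul (by norm_num)]
        refine Real.sqrt_le_sqrt ?_
        rw [mul_pow, pow_two x₀, hx₀2]
        nlinarith [hx.2]
      have h4 : |Q.eval (x₀ * x)| * δ ≤ A * (√2 * √(1 - x)) :=
        (mul_le_mul_of_nonneg_left h2 (abs_nonneg _)).trans
          (h1.trans (mul_le_mul_of_nonneg_left h3 hA.le))
      rw [hRe, div_mul_eq_mul_div, div_mul_eq_mul_div, le_div_iff₀ hδ0]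
      linarith
    intro x hx
    constructor
    · rw [← hRe]
      refine (hRb x ⟨by linarith [hx.1], hx.2⟩).trans ?_
      calc √2 / δ * A * √(1 - x) ≤ √2 / δ * A * 1 := by
            gcongr
            rw [Real.sqrt_le_one]
            linarith [hx.1]
        _ ≤ K * A := by
            rw [mul_one]
            gcongr
            exact le_max_left _ _
    · have h1 := abs_derivative_eval_le_of_abs_eval_le_sqrt hRd hN1
        (A := √2 / δ * A) (by positivity) hδ0 hRb x hx
      have h2 : R.derivative.eval x = x₀ * Q.derivative.eval (x₀ * x) := by
        simp [hR, derivative_comp]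
      rw [h2, abs_mul, hx₀a, one_mul] at h1
      refine h1.trans ?_
      calc 48 * N / √δ * (√2 / δ * A) = 48 / √δ * (√2 / δ) * N * A := by ring
        _ ≤ K * N * A := by
            gcongr
            exact le_max_right _ _
  have hKpos : 0 < K := lt_max_of_lt_left (by positivity)
  rcases hx₀ with rfl | rfl
  · refine ⟨1 - δ / 4, 1, K, by linarith, hKpos, Icc_subset_Icc_left (by linarith),
      ⟨by linarith, le_rfl⟩, ?_, fun Q N A hN hN1 hA hQ x hx => ?_⟩
    · filter_upwards [Ioi_mem_nhds (show 1 - δ / 4 < 1 by linarith)] with y hy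
      have hy : 1 - δ / 4 < y := hy
      exact propext ⟨fun h => ⟨by linarith, h.2⟩, fun h => ⟨hy.le, h.2⟩⟩
    · simpa using hcore Q N A hN hN1 hA hQ x hx
  · refine ⟨-1, -1 + δ / 4, K, by linarith, hKpos, Icc_subset_Icc_right (by linarith),
      ⟨le_rfl, by linarith⟩, ?_, fun Q N A hN hN1 hA hQ x hx => ?_⟩
    · filter_upwards [Iio_mem_nhds (show -1 < -1 + δ / 4 by linarith)] with y hy
      have hy : y < -1 + δ / 4 := hy
      exact propext ⟨fun h => ⟨h.1, by linarith⟩, fun h => ⟨h.1, hy.le⟩⟩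
    · simpa using hcore Q N A hN hN1 hA hQ (-x) ⟨by linarith [hx.2], by linarith [hx.1]⟩

namespace HasLobattoErrorBound
variable {f : ℝ → ℝ} {ξ e : ℝ}

lemma isBigO_regular_interior (h : HasLobattoErrorBound f ξ e) (he : 0 < e)
    (hf : ContinuousOn f (Icc (-1) 1)) {x : ℝ} (hx : x ∈ Ioo (-1 : ℝ) 1) (hne : x ≠ ξ) {m : ℕ}
    (hm : (m : ℝ) - 1 - e < 0) :
    (fun n : ℕ => chebDiffError f m n x) =O[atTop] fun n : ℕ => (n : ℝ) ^ ((m : ℝ) - 1 - e) := by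
  obtain ⟨C, n₀, hn₀, hC, hb⟩ := h.exists_dyadic_le he
  have hpos : 0 < |x - ξ| := abs_pos.2 (sub_ne_zero.2 hne)
  -- Bernstein's inequality on radius `δ` needs values on radius `2δ`; the factor `3` keeps these at
  -- distance `δ` from `ξ`.
  obtain ⟨δ, hδ, hδ1, hδ2, hδ3⟩ : ∃ δ : ℝ, 0 < δ ∧ -1 ≤ x - 2 * δ ∧ x + 2 * δ ≤ 1 ∧
      3 * δ ≤ |x - ξ| := by
    refine ⟨min (min ((x + 1) / 2) ((1 - x) / 2)) (|x - ξ| / 3), ?_, ?_, ?_, ?_⟩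
    · have h1 := hx.1
      have h2 := hx.2
      exact lt_min (lt_min (by linarith) (by linarith)) (by positivity)
    · have := (min_le_left (min ((x + 1) / 2) ((1 - x) / 2)) (|x - ξ| / 3)).trans (min_le_left _ _)
      linarith
    · have := (min_le_left (min ((x + 1) / 2) ((1 - x) / 2)) (|x - ξ| / 3)).trans (min_le_right _ _)
      linarith
    · have := min_le_right (min ((x + 1) / 2) ((1 - x) / 2)) (|x - ξ| / 3)
      linarith
  refine h.chebDiffError_isBigO he hf (a := x - δ) (b := x + δ) (by linarith)
    (Icc_subset_Icc (by linarith) (by linarith)) ⟨by linarith, by linarith⟩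
    (Icc_eventuallyEq_Icc_of_mem_Ioo ⟨by linarith, by linarith⟩ (by linarith) (by linarith))
    hm hn₀ fun j hj => ?_
  obtain ⟨K, hK, hbern⟩ := exists_abs_iterate_derivative_eval_le_bernstein j
  refine ⟨K * (2 / δ) ^ j * (C / δ), fun n hn y hy => ?_⟩
  have hn1 : (1 : ℝ) ≤ n := by exact_mod_cast hn₀.trans hn
  have hj' : (j : ℝ) ≤ m := by exact_mod_cast hj
  refine (hbern _ (2 * n) (C / δ * (n : ℝ) ^ (-1 - e)) x δ δ (natDegree_dyadic_sub_le f n)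
    (by omega) hδ (by positivity) (fun w hw => ?_) y
    (abs_le.2 ⟨by linarith [hy.1], by linarith [hy.2]⟩)).trans ?_
  · have hw' := abs_le.1 hw
    have h1 := hb n hn w ⟨by linarith [hw'.1], by linarith [hw'.2]⟩
    have h2 : δ ≤ |w - ξ| := by
      have := abs_sub_le x w ξ
      rw [abs_sub_comm x w] at this
      linarith
    have h3 : √(1 - w ^ 2) ≤ 1 := Real.sqrt_le_one.2 (by nlinarith [sq_nonneg w])
    rw [div_mul_eq_mul_div, le_div_iff₀ hδ]
    calc _ ≤ _ := mul_le_mul_of_nonneg_left h2 (abs_nonneg _)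
      _ ≤ _ := h1
      _ ≤ C * (1 * (n : ℝ) ^ (-1 - e)) := by gcongr
      _ = _ := by rw [one_mul]
  · have h1 := pow_mul_rpow_le (j := j) hn1 (show (j : ℝ) + (-1 - e) ≤ m - 1 - e by linarith)
    push_cast
    calc _ = K * (2 / δ) ^ j * (C / δ) * ((n : ℝ) ^ j * (n : ℝ) ^ (-1 - e)) := by
          rw [mul_div_right_comm, mul_pow]
          ring
      _ ≤ _ := by gcongr

/-- Outside a gap of order `1/n` dividing by `|w - ξ|` loses one factor `n`; the gap is then filled
in, and each derivative costs another `n`. -/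
lemma isBigO_singular_interior (h : HasLobattoErrorBound f ξ e) (he : 0 < e)
    (hf : ContinuousOn f (Icc (-1) 1)) (hξ : ξ ∈ Ioo (-1 : ℝ) 1) {m : ℕ} (hm : (m : ℝ) - e < 0) :
    (fun n : ℕ => chebDiffError f m n ξ) =O[atTop] fun n : ℕ => (n : ℝ) ^ ((m : ℝ) - e) := by
  obtain ⟨C, n₀, hn₀, hC, hb⟩ := h.exists_dyadic_le he
  obtain ⟨δ, hδ, hδ1, hδ2⟩ : ∃ δ : ℝ, 0 < δ ∧ -1 ≤ ξ - δ ∧ ξ + δ ≤ 1 := by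
    refine ⟨min (ξ + 1) (1 - ξ), lt_min (by linarith [hξ.1]) (by linarith [hξ.2]), ?_, ?_⟩
    · linarith [min_le_left (ξ + 1) (1 - ξ)]
    · linarith [min_le_right (ξ + 1) (1 - ξ)]
  refine h.chebDiffError_isBigO he hf (a := ξ - δ / 2) (b := ξ + δ / 2) (by linarith)
    (Icc_subset_Icc (by linarith) (by linarith)) ⟨by linarith, by linarith⟩
    (Icc_eventuallyEq_Icc_of_mem_Ioo ⟨by linarith, by linarith⟩ (by linarith) (by linarith))
    hm hn₀ fun j hj => ?_
  obtain ⟨K, hK, hbern⟩ := exists_abs_iterate_derivative_eval_le_bernstein j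
  refine ⟨K * (4 / δ) ^ j * (2 * (128 * C / δ)), fun n hn y hy => ?_⟩
  have hn1 : (1 : ℝ) ≤ n := by exact_mod_cast hn₀.trans hn
  have hn0 : (0 : ℝ) < n := by linarith
  have hj' : (j : ℝ) ≤ m := by exact_mod_cast hj
  have hsplit : (n : ℝ) ^ (-1 - e) = (n : ℝ) ^ (-e) / n := by
    rw [show -1 - e = -e - 1 by ring, Real.rpow_sub_one hn0.ne']
  have hglobal := abs_eval_le_of_gap_interior (natDegree_dyadic_sub_le f n) (by omega)
    (A := 128 * C / δ * (n : ℝ) ^ (-e)) (by positivity) hδ hδ1 hδ2 (fun w hw hgap => by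
      have h1 := hb n hn w hw
      have h3 : √(1 - w ^ 2) ≤ 1 := Real.sqrt_le_one.2 (by nlinarith [sq_nonneg w])
      have h4 : |(chebInterp f (2 * n) - chebInterp f n).eval w| * (δ / (64 * (2 * n : ℕ))) ≤
          C * ((n : ℝ) ^ (-e) / n) := by
        calc _ ≤ _ := mul_le_mul_of_nonneg_left hgap (abs_nonneg _)
          _ ≤ _ := h1
          _ ≤ C * (1 * (n : ℝ) ^ (-1 - e)) := by gcongr
          _ = _ := by rw [one_mul, hsplit]
      push_cast at h4
      rw [← mul_div_assoc, div_le_iff₀ (by positivity)] at h4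
      rw [div_mul_eq_mul_div, le_div_iff₀ hδ]
      refine h4.trans (le_of_eq ?_)
      field_simp
      norm_num)
  refine (hbern _ (2 * n) (2 * (128 * C / δ * (n : ℝ) ^ (-e))) ξ (δ / 2) (δ / 2)
    (natDegree_dyadic_sub_le f n) (by omega) (by positivity) (by positivity) (fun w hw => ?_) y
    (abs_le.2 ⟨by linarith [hy.1], by linarith [hy.2]⟩)).trans ?_
  · have hw' := abs_le.1 hw
    exact hglobal w ⟨by linarith [hw'.1], by linarith [hw'.2]⟩
  · have h1 := pow_mul_rpow_le (j := j) hn1 (show (j : ℝ) + (-e) ≤ m - e by linarith)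
    push_cast
    have e1 : (2 * n : ℝ) / (δ / 2) = 4 / δ * n := by field_simp; norm_num
    calc _ = K * (4 / δ) ^ j * (2 * (128 * C / δ)) * ((n : ℝ) ^ j * (n : ℝ) ^ (-e)) := by
          rw [e1, mul_pow]
          ring
      _ ≤ _ := by gcongr

/-- The square-root weight makes the first derivative cost `n`; the other `m - 1` cost `n²` each by
Markov's inequality. In total `1 + 2(m - 1) - 1 - e = 2m - 2 - e`. -/
lemma isBigO_regular_endpoint (h : HasLobattoErrorBound f ξ e) (he : 0 < e)
    (hf : ContinuousOn f (Icc (-1) 1)) (hξ : ξ ∈ Icc (-1 : ℝ) 1) {x : ℝ} (hx : x = 1 ∨ x = -1)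
    (hne : x ≠ ξ) {m : ℕ} (hm1 : 1 ≤ m) (hm : 2 * (m : ℝ) - 2 - e < 0) :
    (fun n : ℕ => chebDiffError f m n x) =O[atTop]
      fun n : ℕ => (n : ℝ) ^ (2 * (m : ℝ) - 2 - e) := by
  obtain ⟨C, n₀, hn₀, hC, hb⟩ := h.exists_dyadic_le he
  obtain ⟨a, b, K, hab, hK, hsub, hxab, hnhds, hedge⟩ := exists_edge_interval hx hξ hne
  have hm1' : (1 : ℝ) ≤ m := by exact_mod_cast hm1
  have hba : 0 < b - a := sub_pos.2 hab
  have hedge' : ∀ n ≥ n₀, _ := fun n hn => hedge (chebInterp f (2 * n) - chebInterp f n) (2 * n)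
    (C * (n : ℝ) ^ (-1 - e)) (natDegree_dyadic_sub_le f n) (by omega)
    (by
      have : (0 : ℝ) < n := by exact_mod_cast (show 0 < n by omega)
      positivity)
    (fun y hy => (hb n hn y hy).trans (le_of_eq (by ring)))
  refine h.chebDiffError_isBigO he hf hab hsub hxab hnhds hm hn₀ fun j hj => ?_
  rcases j with _ | j
  · refine ⟨K * C, fun n hn y hy => ?_⟩
    have hn1 : (1 : ℝ) ≤ n := by exact_mod_cast hn₀.trans hn
    rw [Function.iterate_zero, id]
    refine (hedge' n hn y hy).1.trans ?_
    rw [← mul_assoc]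
    gcongr
    linarith
  · refine ⟨(16 / (b - a)) ^ j * (K * 2 * C), fun n hn y hy => ?_⟩
    have hn1 : (1 : ℝ) ≤ n := by exact_mod_cast hn₀.trans hn
    have hn0 : (0 : ℝ) < n := by linarith
    have hj' : ((j + 1 : ℕ) : ℝ) ≤ m := by exact_mod_cast hj
    push_cast at hj'
    rw [Function.iterate_succ_apply]
    have h1 := abs_iterate_derivative_eval_le_markov
      (natDegree_iterate_derivative_le (natDegree_dyadic_sub_le f n) 1) (by omega) hab
      (M := K * (2 * n : ℕ) * (C * (n : ℝ) ^ (-1 - e))) (by push_cast; positivity)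
      (fun w hw => (hedge' n hn w hw).2) j y hy
    refine h1.trans ?_
    have h2 := pow_mul_rpow_le (j := 2 * j + 1) hn1
      (show ((2 * j + 1 : ℕ) : ℝ) + (-1 - e) ≤ 2 * m - 2 - e by push_cast; linarith)
    push_cast
    calc _ = (16 / (b - a)) ^ j * (K * 2 * C) * ((n : ℝ) ^ (2 * j + 1) * (n : ℝ) ^ (-1 - e)) := by
          rw [show 4 * (2 * (n : ℝ)) ^ 2 / (b - a) = 16 / (b - a) * n ^ 2 by ring, mul_pow,
            ← pow_mul, pow_succ]
          ring
      _ ≤ _ := by gcongr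

/-- Here `√(1 - w²) ≤ 2 √|w - ξ|`, so half of the weight cancels and `|Q|` is at most a multiple of
`n^(-1-e) / √|w - ξ|`. Outside a gap of order `1/n²` this is of order `n^(-e)`, and Markov's
inequality does the rest. -/
lemma isBigO_singular_endpoint (h : HasLobattoErrorBound f ξ e) (he : 0 < e)
    (hf : ContinuousOn f (Icc (-1) 1)) (hξ : ξ = 1 ∨ ξ = -1) {m : ℕ} (hm : 2 * (m : ℝ) - e < 0) :
    (fun n : ℕ => chebDiffError f m n ξ) =O[atTop] fun n : ℕ => (n : ℝ) ^ (2 * (m : ℝ) - e) := by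
  obtain ⟨C, n₀, hn₀, hC, hb⟩ := h.exists_dyadic_le he
  have hξI : ξ ∈ Icc (-1 : ℝ) 1 := by rcases hξ with rfl | rfl <;> norm_num
  refine h.chebDiffError_isBigO he hf (a := -1) (b := 1) (by norm_num) subset_rfl hξI
    EventuallyEq.rfl hm hn₀ fun j hj => ?_
  refine ⟨8 ^ j * (2 * (8 * C)), fun n hn y hy => ?_⟩
  have hn1 : (1 : ℝ) ≤ n := by exact_mod_cast hn₀.trans hn
  have hn0 : (0 : ℝ) < n := by linarith
  have hj' : (j : ℝ) ≤ m := by exact_mod_cast hj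
  have hsplit : (n : ℝ) ^ (-1 - e) = (n : ℝ) ^ (-e) / n := by
    rw [show -1 - e = -e - 1 by ring, Real.rpow_sub_one hn0.ne']
  have hglobal := abs_eval_le_of_gap_endpoint (natDegree_dyadic_sub_le f n) (by omega)
    (A := 8 * C * (n : ℝ) ^ (-e)) (by positivity) hξ (fun w hw hgap => by
      have h1 := hb n hn w hw
      push_cast at hgap
      set v := √|w - ξ| with hv
      have hgap0 : 0 < |w - ξ| := lt_of_lt_of_le (by positivity) hgap
      have hv0 : 0 < v := Real.sqrt_pos.2 hgap0
      have hv2 : v * v = |w - ξ| := Real.mul_self_sqrt (abs_nonneg _)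
      have hvn : 1 ≤ 4 * n * v := by
        have h5 : 1 / (4 * n : ℝ) ≤ v := by
          refine Real.le_sqrt_of_sq_le (le_trans (le_of_eq ?_) hgap)
          ring
        rw [div_le_iff₀ (by positivity)] at h5
        linarith
      have h3 : √(1 - w ^ 2) ≤ 2 * v := by
        rw [show (2 : ℝ) = √4 by rw [show (4 : ℝ) = 2 ^ 2 by norm_num, Real.sqrt_sq (by norm_num)],
          hv, ← Real.sqrt_mul (by norm_num)]
        refine Real.sqrt_le_sqrt ?_
        rcases hξ with rfl | rfl
        · rw [abs_of_nonpos (by linarith [hw.2])]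
          nlinarith [hw.1, hw.2]
        · rw [abs_of_nonneg (by linarith [hw.1])]
          nlinarith [hw.1, hw.2]
      rw [← hv2] at h1
      set q := |(chebInterp f (2 * n) - chebInterp f n).eval w| with hq
      have hq0 : 0 ≤ q := abs_nonneg _
      have h4 : q * v * v ≤ 2 * C * ((n : ℝ) ^ (-e) / n) * v := by
        calc q * v * v = q * (v * v) := by ring
          _ ≤ _ := h1
          _ ≤ C * (2 * v * (n : ℝ) ^ (-1 - e)) := by gcongr
          _ = _ := by rw [hsplit]; ring
      have h5 : q * v ≤ 2 * C * ((n : ℝ) ^ (-e) / n) := le_of_mul_le_mul_right h4 hv0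
      calc q ≤ q * (4 * n * v) := le_mul_of_one_le_right hq0 hvn
        _ = 4 * n * (q * v) := by ring
        _ ≤ 4 * n * (2 * C * ((n : ℝ) ^ (-e) / n)) := by gcongr
        _ = _ := by field_simp; norm_num)
  refine (abs_iterate_derivative_eval_le_markov (natDegree_dyadic_sub_le f n) (by omega)
    (by norm_num) (M := 2 * (8 * C * (n : ℝ) ^ (-e))) (by positivity) hglobal j y hy).trans ?_
  have h2 := pow_mul_rpow_le (j := 2 * j) hn1
    (show ((2 * j : ℕ) : ℝ) + (-e) ≤ 2 * m - e by push_cast; linarith)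
  push_cast
  calc _ = 8 ^ j * (2 * (8 * C)) * ((n : ℝ) ^ (2 * j) * (n : ℝ) ^ (-e)) := by
        rw [show 4 * (2 * (n : ℝ)) ^ 2 / (1 - -1) = 8 * n ^ 2 by ring, mul_pow, ← pow_mul]
        ring
    _ ≤ _ := by gcongr

end HasLobattoErrorBound

/-! ### The theorem. -/

lemma chebDiffError_zero_endpoint (f : ℝ → ℝ) {n : ℕ} (hn : 1 ≤ n) {x : ℝ} (hx : x = 1 ∨ x = -1) :
    chebDiffError f 0 n x = 0 := by
  rw [chebDiffError, iteratedDerivWithin_zero, Function.iterate_zero, id, ← lobattoError_eq]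
  rcases hx with rfl | rfl
  · have h := lobattoError_node f (Finset.mem_range.2 (Nat.succ_pos n))
    rwa [Chebyshev.node_eq_one] at h
  · have h := lobattoError_node f (Finset.mem_range.2 (Nat.lt_succ_self n))
    rwa [Chebyshev.node_eq_neg_one (by omega)] at h


theorem theorem3p1 (g : ℝ → ℝ) (hg : AnalyticOnNhd ℝ g (Icc (-1) 1))
    (ξ σ : ℝ) (hσ : 0 < σ) (m : ℕ) :
    (ξ ∈ Ioo (-1 : ℝ) 1 → (∀ k : ℤ, σ ≠ 2 * (k : ℝ)) → (m : ℝ) < min σ (1 + σ / 2) →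
      ContDiffOn ℝ m (modelFun ξ σ g) (Icc (-1) 1) ∧
      ((fun n : ℕ => chebDiffError (modelFun ξ σ g) m n ξ)
        =O[atTop] fun n : ℕ => (n : ℝ) ^ ((m : ℝ) - σ)) ∧
      (∀ x ∈ Ioo (-1) ξ ∪ Ioo ξ 1,
        (fun n : ℕ => chebDiffError (modelFun ξ σ g) m n x)
          =O[atTop] fun n : ℕ => (n : ℝ) ^ ((m : ℝ) - 1 - σ)) ∧
      (∀ x : ℝ, x = 1 ∨ x = -1 →
        (1 ≤ m →
          (fun n : ℕ => chebDiffError (modelFun ξ σ g) m n x)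
            =O[atTop] fun n : ℕ => (n : ℝ) ^ (2 * (m : ℝ) - 2 - σ)) ∧
        (m = 0 → ∀ n : ℕ, 1 ≤ n → chebDiffError (modelFun ξ σ g) m n x = 0))) ∧
    (ξ = 1 ∨ ξ = -1 → (∀ k : ℤ, σ ≠ (k : ℝ)) → (m : ℝ) < σ →
      ContDiffOn ℝ m (modelFun ξ σ g) (Icc (-1) 1) ∧
      (∀ x ∈ Ioo (-1 : ℝ) 1,
        (fun n : ℕ => chebDiffError (modelFun ξ σ g) m n x)
          =O[atTop] fun n : ℕ => (n : ℝ) ^ ((m : ℝ) - 1 - 2 * σ)) ∧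
      (1 ≤ m →
        ((fun n : ℕ => chebDiffError (modelFun ξ σ g) m n ξ)
          =O[atTop] fun n : ℕ => (n : ℝ) ^ (2 * (m : ℝ) - 2 * σ)) ∧
        ((fun n : ℕ => chebDiffError (modelFun ξ σ g) m n (-ξ))
          =O[atTop] fun n : ℕ => (n : ℝ) ^ (2 * (m : ℝ) - 2 - 2 * σ))) ∧
      (m = 0 → ∀ n : ℕ, 1 ≤ n →
        chebDiffError (modelFun ξ σ g) m n ξ = 0 ∧
        chebDiffError (modelFun ξ σ g) m n (-ξ) = 0)) := by
  refine ⟨fun hξ hσ2 hm => ?_, fun hξ hσ1 hm => ?_⟩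
  · have hB := hasLobattoErrorBound_modelFun_interior hg hξ hσ hσ2
    have hmσ : (m : ℝ) < σ := hm.trans_le (min_le_left _ _)
    -- This makes the exponent `2m - 2 - σ` at `±1` negative; the other two exponents need only `m <
    -- σ`.
    have hmσ' : (m : ℝ) < 1 + σ / 2 := hm.trans_le (min_le_right _ _)
    have hf : ContinuousOn (modelFun ξ σ g) (Icc (-1) 1) := (contDiffOn_modelFun hg ξ hmσ).continuousOn
    refine ⟨contDiffOn_modelFun hg ξ hmσ, hB.isBigO_singular_interior hσ hf hξ (by linarith),
      fun x hx => ?_, fun x hx => ⟨fun hm1 => ?_, fun hm0 n hn => ?_⟩⟩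
    · have hx' : x ∈ Ioo (-1 : ℝ) 1 ∧ x ≠ ξ := by
        rcases hx with hx | hx
        · exact ⟨⟨hx.1, hx.2.trans hξ.2⟩, hx.2.ne⟩
        · exact ⟨⟨hξ.1.trans hx.1, hx.2⟩, hx.1.ne'⟩
      exact hB.isBigO_regular_interior hσ hf hx'.1 hx'.2 (by linarith)
    · refine hB.isBigO_regular_endpoint hσ hf (Ioo_subset_Icc_self hξ) hx ?_ hm1 (by linarith)
      rcases hx with rfl | rfl
      · exact hξ.2.ne'
      · exact hξ.1.ne
    · subst hm0
      exact chebDiffError_zero_endpoint _ hn hx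
  · have hB := hasLobattoErrorBound_modelFun_endpoint hg hξ hσ hσ1
    have hf : ContinuousOn (modelFun ξ σ g) (Icc (-1) 1) := (contDiffOn_modelFun hg ξ hm).continuousOn
    have he : 0 < 2 * σ := by linarith
    have hξ' : -ξ = 1 ∨ -ξ = -1 := by rcases hξ with rfl | rfl <;> simp
    refine ⟨contDiffOn_modelFun hg ξ hm, fun x hx => ?_, fun hm1 => ⟨?_, ?_⟩, fun hm0 n hn => ?_⟩
    · refine hB.isBigO_regular_interior he hf hx ?_ (by linarith)
      rcases hξ with rfl | rfl
      · exact hx.2.ne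
      · exact hx.1.ne'
    · exact hB.isBigO_singular_endpoint he hf hξ (by linarith)
    · refine hB.isBigO_regular_endpoint he hf ?_ hξ' ?_ hm1 (by linarith)
      · rcases hξ with rfl | rfl <;> norm_num
      · rcases hξ with rfl | rfl <;> norm_num
    · subst hm0
      exact ⟨chebDiffError_zero_endpoint _ hn hξ, chebDiffError_zero_endpoint _ hn hξ'⟩
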